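/- An instance of the Equitable Connected Partition problem (ECP) consists of a simple undirected connected graph $G=(V,E)$ with $n=|V|\ge 1$ vertices and an integer $p\ge 1$. The question is whether $V$ has a partition into $p$ parts $V_1,\dots,V_p$ such that every induced subgraph $G[V_i]$ is connected (in particular $V_i\neq\emptyset$) and $\bigl||V_i|-|V_j|\bigr|\le 1$ for all $i,j$. A cograph is a graph that can be built from single-vertex graphs by disjoint unions and complete joins of two vertex-disjoint graphs. **Theorem.** ECP can be solved in polynomial time on cographs; more precisely, in time $O(n^4)$. That is, there are a program for a random access machine (unit-cost operations on natural numbers: reading, writing, addition, truncated subtraction, test for zero; no multiplication) and a constant $C$ such that for every connected cograph $G$ on $n$ vertices and every integer $p\ge 1$, the program, given $n$, $p$ and the adjacency matrix of $G$, halts after at most $C n^4$ steps with the correct answer to the ECP instance $(G,p)$. -/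

import Mathlib

namespace ECP

/-! ### The problem -/

/-- `P 0, …, P (p - 1)` is a partition of the vertex set into `p` parts, each of which induces a
connected (in particular non-empty) subgraph, and the sizes of any two parts differ by at most
one. -/
structure IsEquitableConnectedPartition {V : Type*} [Fintype V] (G : SimpleGraph V) {p : ℕ}
    (P : Fin p → Finset V) : Prop where
  disjoint : ∀ i j, i ≠ j → Disjoint (P i) (P j)
  cover : ∀ v, ∃ i, v ∈ P i
  connected : ∀ i, (G.induce (P i : Set V)).Connected
  equitable : ∀ i j, (P i).card ≤ (P j).card + 1

/-- The question asked by the Equitable Connected Partition problem on the instance `(G, p)`. -/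
def IsYesInstance {V : Type*} [Fintype V] (G : SimpleGraph V) (p : ℕ) : Prop :=
  ∃ P : Fin p → Finset V, IsEquitableConnectedPartition G P

/-! ### Cographs -/

/-- `CographOn G S`: the subgraph of `G` induced by the vertex set `S` can be built from single
vertices by disjoint unions and complete joins of two vertex-disjoint graphs. A derivation is a
binary cotree whose set of leaves is `S`. -/
inductive CographOn {V : Type*} [DecidableEq V] (G : SimpleGraph V) : Finset V → Prop
  | single (v : V) : CographOn G {v}
  | union (A B : Finset V) : CographOn G A → CographOn G B → Disjoint A B →
      (∀ a ∈ A, ∀ b ∈ B, ¬ G.Adj a b) → CographOn G (A ∪ B)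
  | join (A B : Finset V) : CographOn G A → CographOn G B → Disjoint A B →
      (∀ a ∈ A, ∀ b ∈ B, G.Adj a b) → CographOn G (A ∪ B)

/-- A finite graph is a cograph if it has a cotree. -/
def IsCograph {V : Type*} [Fintype V] [DecidableEq V] (G : SimpleGraph V) : Prop :=
  CographOn G Finset.univ

/-! ### The machine model

A random access machine with natural-number cells, programmed by structured programs. It has
registers and random access arrays; the only arithmetic operations are addition and truncated
subtraction. There is no multiplication, so the numbers that occur in the first `t` steps
have at most `O(t)` more binary digits than those in the input, and a polynomial number of steps
is polynomial time on a Turing machine. A program mentions only finitely many registers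
and arrays, all by fixed names. -/

/-- Memory: register `i` holds `reg i`, cell `k` of array `a` holds `arr a k`. -/
structure Memory where
  reg : ℕ → ℕ
  arr : ℕ → ℕ → ℕ

/-- Arithmetic expressions; `get a e` reads the cell of array `a` with address `e`. -/
inductive Expr
  | const (c : ℕ)
  | reg (i : ℕ)
  | get (a : ℕ) (e : Expr)
  | add (e₁ e₂ : Expr)
  | sub (e₁ e₂ : Expr)

/-- The value of an expression. -/
def Expr.eval (m : Memory) : Expr → ℕ
  | const c => c
  | reg i => m.reg i
  | get a e => m.arr a (e.eval m)
  | add e₁ e₂ => e₁.eval m + e₂.eval m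
  | sub e₁ e₂ => e₁.eval m - e₂.eval m

/-- The number of steps taken to evaluate an expression: one for each operation in it. -/
def Expr.cost : Expr → ℕ
  | const _ => 1
  | reg _ => 1
  | get _ e => e.cost + 1
  | add e₁ e₂ => e₁.cost + e₂.cost + 1
  | sub e₁ e₂ => e₁.cost + e₂.cost + 1

/-- Programs. `assign i e` sets register `i` to `e`; `put a e₁ e₂` sets the cell of array `a` with
address `e₁` to `e₂`; `cond e c₁ c₂` runs `c₁` if `e` is nonzero and `c₂` otherwise; `loop e c`
runs `c` as long as `e` is nonzero. -/
inductive Program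
  | skip
  | assign (i : ℕ) (e : Expr)
  | put (a : ℕ) (e₁ e₂ : Expr)
  | seq (c₁ c₂ : Program)
  | cond (e : Expr) (c₁ c₂ : Program)
  | loop (e : Expr) (c : Program)

/-- `Exec c m m' t`: started in memory `m`, the program `c` halts in memory `m'` after exactly `t`
steps. Execution is deterministic: `m` and `c` determine `m'` and `t`. -/
inductive Exec : Program → Memory → Memory → ℕ → Prop
  | skip (m : Memory) : Exec .skip m m 1
  | assign (m : Memory) (i : ℕ) (e : Expr) :
      Exec (.assign i e) m { m with reg := Function.update m.reg i (e.eval m) } (e.cost + 1)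
  | put (m : Memory) (a : ℕ) (e₁ e₂ : Expr) :
      Exec (.put a e₁ e₂) m
        { m with arr := Function.update m.arr a
                   (Function.update (m.arr a) (e₁.eval m) (e₂.eval m)) }
        (e₁.cost + e₂.cost + 1)
  | seq {c₁ c₂ : Program} {m m' m'' : Memory} {t₁ t₂ : ℕ} :
      Exec c₁ m m' t₁ → Exec c₂ m' m'' t₂ → Exec (.seq c₁ c₂) m m'' (t₁ + t₂)
  | cond_true {e : Expr} {c₁ c₂ : Program} {m m' : Memory} {t : ℕ} :
      e.eval m ≠ 0 → Exec c₁ m m' t → Exec (.cond e c₁ c₂) m m' (e.cost + 1 + t)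
  | cond_false {e : Expr} {c₁ c₂ : Program} {m m' : Memory} {t : ℕ} :
      e.eval m = 0 → Exec c₂ m m' t → Exec (.cond e c₁ c₂) m m' (e.cost + 1 + t)
  | loop_true {e : Expr} {c : Program} {m m' m'' : Memory} {t₁ t₂ : ℕ} :
      e.eval m ≠ 0 → Exec c m m' t₁ → Exec (.loop e c) m' m'' t₂ →
      Exec (.loop e c) m m'' (e.cost + 1 + t₁ + t₂)
  | loop_false {e : Expr} {c : Program} {m : Memory} :
      e.eval m = 0 → Exec (.loop e c) m m (e.cost + 1)

open Classical in
/-- The initial memory for the instance `(G, p)`: register `0` holds the number `n` of vertices,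
register `1` holds `p`, array `0` holds the adjacency matrix of `G` row by row, and everything else
is `0`. -/
noncomputable def inputMemory {n : ℕ} (G : SimpleGraph (Fin n)) (p : ℕ) : Memory where
  reg i := if i = 0 then n else if i = 1 then p else 0
  arr a k := if a = 0 ∧ ∃ i j : Fin n, k = (i : ℕ) * n + (j : ℕ) ∧ G.Adj i j then 1 else 0

/-- Started on the instance `(G, p)`, the program halts after at most `T` steps, and register `0`
then holds the answer: `1` for a yes-instance, `0` for a no-instance. -/
def SolvesWithin (prog : Program) {n : ℕ} (G : SimpleGraph (Fin n)) (p T : ℕ) : Prop :=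
  ∃ (m : Memory) (t : ℕ), Exec prog (inputMemory G p) m t ∧ t ≤ T ∧
    (IsYesInstance G p → m.reg 0 = 1) ∧ (¬ IsYesInstance G p → m.reg 0 = 0)

end ECP

namespace ECP

variable {V : Type*} [DecidableEq V]

/-! Write n = p * q + r with r < p. The parts of an equitable partition must have sizes q and q + 1,
with exactly r of size q + 1, so for p ≤ n the instance asks for `Pack G q univ p r`
(`isYesInstance_iff_pack`); for p > n the answer is no. For q > 0 packings are monotone
(`Pack.anti`): a large part can lose a non-cut vertex, and a small part can be discarded. Hence for
fixed k the feasible s form an initial segment of ℕ, and a vertex set is summarised by a table of n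
+ 1 numbers whose k-th entry counts the feasible s.

Tables combine along a cotree. In a disjoint union every connected part lies on one side, which
gives a convolution (`pack_union_iff`). In a join of A and B at most |B| parts meet B, so A alone
must hold k - |B| parts, s - |B| of them large, and symmetrically for B. Together with s ≤ k and k *
q + s ≤ |A| + |B| these necessary conditions suffice (`pack_join_iff`), because parts through both
sides can be cut almost freely (`pack_mixed`).

No cotree is given, but any two or more vertices of a cograph include twins
(`CographOn.exists_twins`). Each live vertex stands for a module; a round finds live twins, merges
their modules and deletes one of the two. After n - 1 rounds the surviving table is that of the
whole graph. A round costs O(n^3) for the search and O(n^2) for the new table, hence O(n^4) in all.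
-/

/-- `Pack G q S k s`: the vertex set `S` contains `k` disjoint parts that induce connected
subgraphs, `s` of them with `q + 1` vertices and the other ones with `q` vertices. -/
inductive Pack (G : SimpleGraph V) (q : ℕ) : Finset V → ℕ → ℕ → Prop
  | nil (S : Finset V) : Pack G q S 0 0
  | small {S C : Finset V} {k s : ℕ} : C ⊆ S → (G.induce (C : Set V)).Connected → C.card = q →
      Pack G q (S \ C) k s → Pack G q S (k + 1) s
  | large {S C : Finset V} {k s : ℕ} : C ⊆ S → (G.induce (C : Set V)).Connected →
      C.card = q + 1 → Pack G q (S \ C) k s → Pack G q S (k + 1) (s + 1)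

/-! ### Monotonicity of packings -/

namespace Pack

variable {G : SimpleGraph V} {q : ℕ}

theorem mono {S T : Finset V} {k s : ℕ} (h : Pack G q S k s) (hST : S ⊆ T) : Pack G q T k s := by
  induction h generalizing T with
  | nil => exact nil _
  | small hC hc hq _ ih => exact small (hC.trans hST) hc hq (ih (Finset.sdiff_subset_sdiff hST le_rfl))
  | large hC hc hq _ ih => exact large (hC.trans hST) hc hq (ih (Finset.sdiff_subset_sdiff hST le_rfl))

theorem union {A B : Finset V} {k s k' s' : ℕ} (h : Pack G q A k s) (h' : Pack G q B k' s')
    (hd : Disjoint A B) : Pack G q (A ∪ B) (k + k') (s + s') := by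
  have key : ∀ {S C : Finset V}, C ⊆ S → Disjoint S B → S \ C ∪ B ⊆ (S ∪ B) \ C := by
    intro S C hC hd x hx
    have := Finset.disjoint_left.1 hd
    grind
  induction h with
  | nil => simpa using h'.mono Finset.subset_union_right
  | @small S C k s hC hc hq _ ih =>
    rw [Nat.add_right_comm]
    exact small (hC.trans Finset.subset_union_left) hc hq
      ((ih (hd.mono_left Finset.sdiff_subset)).mono (key hC hd))
  | @large S C k s hC hc hq _ ih =>
    rw [Nat.add_right_comm, Nat.add_right_comm s]
    exact large (hC.trans Finset.subset_union_left) hc hq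
      ((ih (hd.mono_left Finset.sdiff_subset)).mono (key hC hd))

/-- Isolates the vertices actually used, so that the number of vertices left over is known exactly.
-/
theorem exists_support {S : Finset V} {k s : ℕ} (h : Pack G q S k s) :
    ∃ U ⊆ S, U.card = k * q + s ∧ Pack G q U k s := by
  have key : ∀ {S C U : Finset V}, C ⊆ S → U ⊆ S \ C → C ∪ U ⊆ S ∧ (C ∪ U) \ C = U ∧
      (C ∪ U).card = C.card + U.card := by
    intro S C U hC hU
    have hd : Disjoint C U := Finset.disjoint_sdiff.mono_right hU
    exact ⟨Finset.union_subset hC (hU.trans Finset.sdiff_subset), Finset.union_sdiff_cancel_left hd,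
      Finset.card_union_of_disjoint hd⟩
  induction h with
  | nil => exact ⟨∅, by simp, by simp, nil _⟩
  | @small S C k s hC hc hq _ ih =>
    obtain ⟨U, hU, hcard, hp⟩ := ih
    obtain ⟨h1, h2, h3⟩ := key hC hU
    exact ⟨C ∪ U, h1, by rw [h3, hcard, hq]; ring,
      small Finset.subset_union_left hc hq (h2.symm ▸ hp)⟩
  | @large S C k s hC hc hq _ ih =>
    obtain ⟨U, hU, hcard, hp⟩ := ih
    obtain ⟨h1, h2, h3⟩ := key hC hU
    exact ⟨C ∪ U, h1, by rw [h3, hcard, hq]; ring,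
      large Finset.subset_union_left hc hq (h2.symm ▸ hp)⟩

theorem card_le {S : Finset V} {k s : ℕ} (h : Pack G q S k s) : k * q + s ≤ S.card := by
  obtain ⟨U, hU, hcard, -⟩ := h.exists_support
  exact hcard ▸ Finset.card_le_card hU

theorem large_le {S : Finset V} {k s : ℕ} (h : Pack G q S k s) : s ≤ k := by
  induction h with
  | nil => simp
  | small => omega
  | large => omega

end Pack

/-- A finite connected graph with at least two vertices has a vertex whose removal leaves it
connected. -/
theorem exists_connected_subset_card_pred {G : SimpleGraph V} {C : Finset V} {q : ℕ} (hq : 0 < q)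
    (hc : (G.induce (C : Set V)).Connected) (hC : C.card = q + 1) :
    ∃ D ⊆ C, (G.induce (D : Set V)).Connected ∧ D.card = q := by
  have : Nontrivial (C : Set V) := by
    rw [Set.nontrivial_coe_sort, Finset.nontrivial_coe, ← Finset.one_lt_card_iff_nontrivial]; omega
  obtain ⟨v, hv⟩ := hc.exists_connected_induce_compl_singleton_of_finite_nontrivial
  refine ⟨C.erase v, Finset.erase_subset _ _, ?_, by rw [Finset.card_erase_of_mem v.2]; omega⟩
  let f : (G.induce (C : Set V)).induce {v}ᶜ →g G.induce (C.erase v : Set V) :=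
    { toFun := fun x => ⟨x.1.1, by
        have h1 := x.1.2
        have h2 : x.1 ≠ v := x.2
        simp only [Finset.mem_coe, Finset.mem_erase]
        exact ⟨fun h => h2 (Subtype.ext h), h1⟩⟩
      map_rel' := fun h => h }
  refine hv.map f ?_
  rintro ⟨x, hx⟩
  have hx' := Finset.mem_erase.1 hx
  exact ⟨⟨⟨x, hx'.2⟩, fun h => hx'.1 (congrArg Subtype.val h)⟩, rfl⟩

namespace Pack

variable {G : SimpleGraph V} {q : ℕ}

theorem of_large_succ (hq : 0 < q) {S : Finset V} {k s : ℕ} (h : Pack G q S k (s + 1)) :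
    Pack G q S k s := by
  generalize hs : s + 1 = s' at h
  induction h generalizing s with
  | nil => omega
  | small hC hc hcard _ ih => exact small hC hc hcard (ih hs)
  | large hC hc hcard hp ih =>
    obtain ⟨D, hD, hDc, hDcard⟩ := exists_connected_subset_card_pred hq hc hcard
    obtain rfl : s = _ := Nat.succ_injective hs
    exact small (hD.trans hC) hDc hDcard (hp.mono (Finset.sdiff_subset_sdiff le_rfl hD))

/-- Since s ≤ k, not all k + 1 parts are large, and a small one can be dropped. -/
theorem of_succ {S : Finset V} {k s : ℕ} (h : Pack G q S (k + 1) s) (hs : s ≤ k) :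
    Pack G q S k s := by
  generalize hk : k + 1 = k' at h
  induction h generalizing k with
  | nil => omega
  | small hC hc hcard hp ih =>
    obtain rfl : k = _ := Nat.succ_injective hk
    exact hp.mono Finset.sdiff_subset
  | @large S C k' s hC hc hcard hp ih =>
    obtain ⟨k, rfl⟩ : ∃ j, k = j + 1 := ⟨k - 1, by omega⟩
    exact large hC hc hcard (ih (by omega) (by omega))

/-- Shrink large parts first, then drop small ones. This is what lets a single number per k record
all feasible s. -/
theorem anti (hq : 0 < q) {S : Finset V} {k s k' s' : ℕ} (h : Pack G q S k s) (hk : k' ≤ k)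
    (hs : s' ≤ s) (hsk : s' ≤ k') : Pack G q S k' s' := by
  have h1 : Pack G q S k s' := by
    induction s, hs using Nat.le_induction with
    | base => exact h
    | succ s _ ih => exact ih (h.of_large_succ hq)
  clear h
  induction k, hk using Nat.le_induction with
  | base => exact h1
  | succ k hk ih => exact ih (h1.of_succ (hsk.trans hk))

end Pack

/-! ### Packings in disjoint unions and complete joins -/

/-- Otherwise a walk inside C from A to B would leave A along an edge between A and B. -/
theorem subset_or_subset_of_connected {G : SimpleGraph V} {A B C : Finset V}
    (hAB : ∀ a ∈ A, ∀ b ∈ B, ¬ G.Adj a b) (hC : C ⊆ A ∪ B)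
    (hc : (G.induce (C : Set V)).Connected) : C ⊆ A ∨ C ⊆ B := by
  by_contra! h
  obtain ⟨⟨b, hbC, hbA⟩, ⟨a, haC, haB⟩⟩ := And.imp Finset.not_subset.1 Finset.not_subset.1 h
  have haA : a ∈ A := by have := hC haC; grind
  obtain ⟨w⟩ := hc.preconnected ⟨a, haC⟩ ⟨b, hbC⟩
  obtain ⟨d, -, h1, h2⟩ := w.exists_boundary_dart {x | x.1 ∈ A} haA hbA
  have h3 : d.snd.1 ∈ B := by
    have := hC d.snd.2
    have h2' : d.snd.1 ∉ A := h2
    grind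
  exact hAB _ h1 _ h3 d.adj

/-- Stated for subsets S of A ∪ B because the induction removes one part at a time from S. -/
theorem Pack.split {G : SimpleGraph V} {q : ℕ} {A B : Finset V}
    (hAB : ∀ a ∈ A, ∀ b ∈ B, ¬ G.Adj a b) {S : Finset V} {k s : ℕ} (h : Pack G q S k s)
    (hS : S ⊆ A ∪ B) : ∃ k₁ s₁ k₂ s₂, k₁ + k₂ = k ∧ s₁ + s₂ = s ∧ Pack G q (S ∩ A) k₁ s₁ ∧
      Pack G q (S ∩ B) k₂ s₂ := by
  have key : ∀ {S C D : Finset V}, (S \ C) ∩ D ⊆ (S ∩ D) \ C := by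
    intro S C D; grind
  induction h with
  | nil => exact ⟨0, 0, 0, 0, rfl, rfl, nil _, nil _⟩
  | small hC hc hq _ ih =>
    obtain ⟨k₁, s₁, k₂, s₂, hk, hs, h1, h2⟩ := ih (Finset.sdiff_subset.trans hS)
    rcases subset_or_subset_of_connected hAB (hC.trans hS) hc with h | h
    · exact ⟨k₁ + 1, s₁, k₂, s₂, by omega, hs,
        small (Finset.subset_inter hC h) hc hq (h1.mono key), h2.mono (by grind)⟩
    · exact ⟨k₁, s₁, k₂ + 1, s₂, by omega, hs, h1.mono (by grind),
        small (Finset.subset_inter hC h) hc hq (h2.mono key)⟩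
  | large hC hc hq _ ih =>
    obtain ⟨k₁, s₁, k₂, s₂, hk, hs, h1, h2⟩ := ih (Finset.sdiff_subset.trans hS)
    rcases subset_or_subset_of_connected hAB (hC.trans hS) hc with h | h
    · exact ⟨k₁ + 1, s₁ + 1, k₂, s₂, by omega, by omega,
        large (Finset.subset_inter hC h) hc hq (h1.mono key), h2.mono (by grind)⟩
    · exact ⟨k₁, s₁, k₂ + 1, s₂ + 1, by omega, by omega, h1.mono (by grind),
        large (Finset.subset_inter hC h) hc hq (h2.mono key)⟩

theorem pack_union_iff {G : SimpleGraph V} {q : ℕ} {A B : Finset V} (hd : Disjoint A B)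
    (hAB : ∀ a ∈ A, ∀ b ∈ B, ¬ G.Adj a b) {k s : ℕ} :
    Pack G q (A ∪ B) k s ↔ ∃ k₁ ≤ k, ∃ s₁ s₂, s₁ + s₂ = s ∧ Pack G q A k₁ s₁ ∧
      Pack G q B (k - k₁) s₂ := by
  constructor
  · intro h
    obtain ⟨k₁, s₁, k₂, s₂, hk, hs, h1, h2⟩ := h.split hAB le_rfl
    refine ⟨k₁, by omega, s₁, s₂, hs, h1.mono Finset.inter_subset_right, ?_⟩
    rw [← hk, Nat.add_sub_cancel_left]
    exact h2.mono Finset.inter_subset_right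
  · rintro ⟨k₁, hk, s₁, s₂, rfl, h1, h2⟩
    have := h1.union h2 hd
    rwa [Nat.add_sub_cancel' hk] at this

/-- Disjoint parts that meet B use up distinct vertices of B, so at most |S ∩ B| parts do. The
others lie in A. -/
theorem Pack.avoid {G : SimpleGraph V} {q : ℕ} {A B : Finset V} {S : Finset V} {k s : ℕ}
    (h : Pack G q S k s) (hS : S ⊆ A ∪ B) : ∃ k' s', k ≤ k' + (S ∩ B).card ∧
      s ≤ s' + (S ∩ B).card ∧ Pack G q (S ∩ A) k' s' := by
  have key : ∀ {S C : Finset V}, C ⊆ S → (¬ ∃ x ∈ C, x ∈ B) → S ⊆ A ∪ B → C ⊆ S ∩ A ∧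
      (S \ C) ∩ B = S ∩ B := by
    intro S C hC h hS
    refine ⟨fun x hx => ?_, ?_⟩
    · have := hS (hC hx); grind
    · grind
  have key' : ∀ {S C : Finset V}, C ⊆ S → (∃ x ∈ C, x ∈ B) →
      ((S \ C) ∩ B).card < (S ∩ B).card := by
    rintro S C hC ⟨x, hx, hxB⟩
    refine Finset.card_lt_card ⟨by grind, fun h => ?_⟩
    have := h (Finset.mem_inter.2 ⟨hC hx, hxB⟩)
    grind
  have key'' : ∀ {S C D : Finset V}, (S \ C) ∩ D ⊆ (S ∩ D) \ C := by
    intro S C D; grind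
  induction h with
  | nil => exact ⟨0, 0, by simp, by simp, nil _⟩
  | @small S C k s hC hc hq _ ih =>
    obtain ⟨k', s', hk, hs, hp⟩ := ih (Finset.sdiff_subset.trans hS)
    by_cases h : ∃ x ∈ C, x ∈ B
    · have := key' hC h
      exact ⟨k', s', by omega, by omega, hp.mono (by grind)⟩
    · obtain ⟨h1, h2⟩ := key hC h hS
      rw [h2] at hk hs
      exact ⟨k' + 1, s', by omega, by omega, small h1 hc hq (hp.mono key'')⟩
  | @large S C k s hC hc hq _ ih =>
    obtain ⟨k', s', hk, hs, hp⟩ := ih (Finset.sdiff_subset.trans hS)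
    by_cases h : ∃ x ∈ C, x ∈ B
    · have := key' hC h
      exact ⟨k', s', by omega, by omega, hp.mono (by grind)⟩
    · obtain ⟨h1, h2⟩ := key hC h hS
      rw [h2] at hk hs
      exact ⟨k' + 1, s' + 1, by omega, by omega, large h1 hc hq (hp.mono key'')⟩

theorem Pack.left_of_union {G : SimpleGraph V} {q : ℕ} (hq : 0 < q) {A B : Finset V}
    {k s : ℕ} (h : Pack G q (A ∪ B) k s) : Pack G q A (k - B.card) (s - B.card) := by
  obtain ⟨k', s', hk, hs, hp⟩ := h.avoid le_rfl
  have h1 : ((A ∪ B) ∩ B).card = B.card := by congr 1; grind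
  have := h.large_le
  exact (hp.mono Finset.inter_subset_right).anti hq (by omega) (by omega) (by omega)

/-- All of X is adjacent to all of Y, so one vertex on each side already links everything; with X
empty, Y has to be a single vertex. -/
theorem connected_of_join {G : SimpleGraph V} {A B : Finset V}
    (hAB : ∀ a ∈ A, ∀ b ∈ B, G.Adj a b) {X Y : Finset V} (hX : X ⊆ A) (hY : Y ⊆ B)
    (hYne : Y.Nonempty) (h : X.Nonempty ∨ Y.card = 1) :
    (G.induce ((X ∪ Y : Finset V) : Set V)).Connected := by
  obtain ⟨y, hy⟩ := hYne
  have hyU : y ∈ ((X ∪ Y : Finset V) : Set V) := by simp [hy]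
  have hXadj : ∀ x (hx : x ∈ X) (z) (hz : z ∈ Y),
      (G.induce ((X ∪ Y : Finset V) : Set V)).Reachable
        ⟨x, by simp [hx]⟩ ⟨z, by simp [hz]⟩ := by
    intro x hx z hz
    refine SimpleGraph.Adj.reachable ?_
    exact hAB x (hX hx) z (hY hz)
  have : ∀ z, (G.induce ((X ∪ Y : Finset V) : Set V)).Reachable z ⟨y, hyU⟩ := by
    rintro ⟨z, hz⟩
    have hz' : z ∈ X ∪ Y := hz
    rcases Finset.mem_union.1 hz' with hz' | hz'
    · exact hXadj z hz' y hy
    · rcases h with ⟨x, hx⟩ | h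
      · exact (hXadj x hx z hz').symm.trans (hXadj x hx y hy)
      · obtain rfl : z = y := Finset.card_le_one.1 h.le z hz' y hy
        exact SimpleGraph.Reachable.refl _
  exact { preconnected := fun a b => (this a).trans (this b).symm, nonempty := ⟨⟨y, hyU⟩⟩ }

/-- Parts through a complete join, each of them containing a vertex of `B`. -/
theorem pack_mixed {G : SimpleGraph V} {q : ℕ} (hq : 0 < q) {j i : ℕ} {A B : Finset V}
    (hd : Disjoint A B) (hAB : ∀ a ∈ A, ∀ b ∈ B, G.Adj a b) (hij : i ≤ j) (hjB : j ≤ B.card)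
    (hiA : i ≤ A.card) (hjA : 2 ≤ q → j ≤ A.card) (hcard : j * q + i ≤ A.card + B.card) :
    Pack G q (A ∪ B) j i := by
  induction j generalizing i A B with
  | zero =>
    obtain rfl : i = 0 := by omega
    exact Pack.nil _
  | succ j ih =>
    -- Cut off one part with x vertices of A and y of B, and apply induction to the rest. The
    -- inequalities demanded last are the hypotheses of the lemma for the remaining j parts.
    have step : ∀ x y, x ≤ A.card → y ≤ B.card → 1 ≤ y → (1 ≤ x ∨ y = 1) →
        ∃ X ⊆ A, ∃ Y ⊆ B, X.card = x ∧ Y.card = y ∧ X ∪ Y ⊆ A ∪ B ∧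
          (G.induce ((X ∪ Y : Finset V) : Set V)).Connected ∧ (X ∪ Y).card = x + y ∧
          (∀ i', i' ≤ j → j + y ≤ B.card → i' + x ≤ A.card → (2 ≤ q → j + x ≤ A.card) →
            j * q + i' + x + y ≤ A.card + B.card → Pack G q ((A ∪ B) \ (X ∪ Y)) j i') := by
      intro x y hx hy hy1 hxy
      obtain ⟨X, hX, hXc⟩ := Finset.exists_subset_card_eq hx
      obtain ⟨Y, hY, hYc⟩ := Finset.exists_subset_card_eq hy
      refine ⟨X, hX, Y, hY, hXc, hYc, Finset.union_subset_union hX hY, ?_, ?_, ?_⟩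
      · refine connected_of_join hAB hX hY (Finset.card_pos.1 (by omega)) ?_
        rw [← Finset.card_pos]; omega
      · rw [Finset.card_union_of_disjoint (hd.mono hX hY), hXc, hYc]
      · intro i' h1 h2 h3 h4 h5
        have e1 := Finset.card_sdiff_of_subset hX
        have e2 := Finset.card_sdiff_of_subset hY
        refine (ih (A := A \ X) (B := B \ Y) (hd.mono Finset.sdiff_subset Finset.sdiff_subset)
          (fun a ha b hb => hAB a (Finset.sdiff_subset ha) b (Finset.sdiff_subset hb)) h1
          (by omega) (by omega) (fun h => by have := h4 h; omega) (by omega)).mono ?_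
        have := Finset.disjoint_left.1 hd
        intro z hz
        have hX' := @hX z
        have hY' := @hY z
        have := @this z
        grind
    rw [Nat.succ_mul] at hcard
    have hjq : 2 ≤ q → j * 2 ≤ j * q := fun h => Nat.mul_le_mul_left _ h
    rcases Nat.eq_zero_or_pos i with rfl | hi
    · have : ∃ x y, x + y = q ∧ 1 ≤ y ∧ (1 ≤ x ∨ y = 1) ∧ j + y ≤ B.card ∧ x ≤ A.card ∧
          (2 ≤ q → j + x ≤ A.card) := by
        rcases Nat.lt_or_ge q 2 with h | h
        · exact ⟨0, 1, by omega, le_rfl, Or.inr rfl, by omega, by omega, by omega⟩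
        · have := hjA h
          have := hjq h
          -- Take as much from A as possible, keeping one vertex of the part in B and j vertices of
          -- A for later parts. If A is the bottleneck, enough of B remains because j * 2 ≤ j * q.
          refine ⟨min (q - 1) (A.card - j), q - min (q - 1) (A.card - j), ?_⟩
          omega
      obtain ⟨x, y, h1, h2, h3, h4, h5, h6⟩ := this
      obtain ⟨X, hX, Y, hY, hXc, hYc, hsub, hconn, hc, hp⟩ := step x y h5 (by omega) h2 h3
      exact Pack.small hsub hconn (by omega) (hp 0 (by omega) h4 (by omega) h6 (by omega))
    · obtain ⟨i, rfl⟩ : ∃ i', i = i' + 1 := ⟨i - 1, by omega⟩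
      have : ∃ x y, x + y = q + 1 ∧ 1 ≤ y ∧ 1 ≤ x ∧ j + y ≤ B.card ∧ i + x ≤ A.card ∧
          (2 ≤ q → j + x ≤ A.card) := by
        rcases Nat.lt_or_ge q 2 with h | h
        · exact ⟨1, 1, by omega, le_rfl, le_rfl, by omega, by omega, by omega⟩
        · have := hjA h
          have := hjq h
          -- The same choice for a part of q + 1 vertices.
          refine ⟨min q (A.card - j), q + 1 - min q (A.card - j), ?_⟩
          omega
      obtain ⟨x, y, h1, h2, h3, h4, h5, h6⟩ := this
      obtain ⟨X, hX, Y, hY, hXc, hYc, hsub, hconn, hc, hp⟩ :=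
        step x y (by omega) (by omega) h2 (Or.inl h3)
      exact Pack.large hsub hconn (by omega) (hp i (by omega) h4 h5 h6 (by omega))

/-- If k ≤ |B|, every part can get its own vertex of the smaller side B. Otherwise k - |B| parts are
packed inside A, and |B| mixed parts are made from B and the unused vertices of A, which the size
bound shows to be numerous enough. -/
theorem pack_join_of_card_le {G : SimpleGraph V} {q : ℕ} (hq : 0 < q) {A B : Finset V}
    (hd : Disjoint A B) (hAB : ∀ a ∈ A, ∀ b ∈ B, G.Adj a b) (hle : B.card ≤ A.card) {k s : ℕ}
    (hs : s ≤ k) (hcard : k * q + s ≤ A.card + B.card)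
    (h : Pack G q A (k - B.card) (s - B.card)) : Pack G q (A ∪ B) k s := by
  rcases Nat.le_total k B.card with hk | hk
  · exact pack_mixed hq hd hAB hs hk (by omega) (fun _ => by omega) hcard
  · obtain ⟨U, hU, hUc, hp⟩ := h.exists_support
    have e := Finset.card_sdiff_of_subset hU
    have hUA := Finset.card_le_card hU
    have e1 : (k - B.card) * q + B.card * q = k * q := by rw [← Nat.add_mul]; congr 1; omega
    have e2 : 2 ≤ q → B.card * 2 ≤ B.card * q := fun h => Nat.mul_le_mul_left _ h
    have e3 : B.card * 1 ≤ B.card * q := Nat.mul_le_mul_left _ hq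
    have hm : Pack G q (A \ U ∪ B) B.card (s - (s - B.card)) :=
      pack_mixed hq (hd.mono_left Finset.sdiff_subset)
        (fun a ha b hb => hAB a (Finset.sdiff_subset ha) b hb) (by omega) le_rfl (by omega)
        (fun h => by have := e2 h; omega) (by omega)
    have := hp.union hm (by
      rw [Finset.disjoint_union_right]
      exact ⟨Finset.disjoint_sdiff, hd.mono_left hU⟩)
    rw [← Finset.union_assoc, Finset.union_sdiff_of_subset hU] at this
    convert this using 1 <;> omega

/-- Only the condition on the larger side is needed for sufficiency. Stating both keeps the
criterion symmetric, so it can be evaluated without comparing |A| and |B|. -/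
theorem pack_join_iff {G : SimpleGraph V} {q : ℕ} (hq : 0 < q) {A B : Finset V}
    (hd : Disjoint A B) (hAB : ∀ a ∈ A, ∀ b ∈ B, G.Adj a b) {k s : ℕ} :
    Pack G q (A ∪ B) k s ↔ s ≤ k ∧ k * q + s ≤ A.card + B.card ∧
      Pack G q A (k - B.card) (s - B.card) ∧ Pack G q B (k - A.card) (s - A.card) := by
  constructor
  · intro h
    refine ⟨h.large_le, ?_, h.left_of_union hq, ?_⟩
    · rw [← Finset.card_union_of_disjoint hd]; exact h.card_le
    · rw [Finset.union_comm] at h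
      exact h.left_of_union hq
  · rintro ⟨hs, hc, h1, h2⟩
    rcases Nat.le_total B.card A.card with hle | hle
    · exact pack_join_of_card_le hq hd hAB hle hs hc h1
    · rw [Finset.union_comm]
      exact pack_join_of_card_le hq hd.symm (fun b hb a ha => (hAB a ha b hb).symm) hle hs
        (by omega) h2

theorem pack_singleton_iff {G : SimpleGraph V} {q : ℕ} (hq : 0 < q) (v : V) (k s : ℕ) :
    Pack G q {v} k s ↔ s = 0 ∧ (k = 0 ∨ k = 1 ∧ q = 1) := by
  constructor
  · intro h
    have h1 := h.card_le
    rw [Finset.card_singleton] at h1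
    have h2 := h.large_le
    have h3 : k * 1 ≤ k * q := Nat.mul_le_mul_left _ hq
    rcases Nat.lt_or_ge k 1 with hk | hk
    · omega
    · obtain rfl : k = 1 := by omega
      omega
  · rintro ⟨rfl, rfl | ⟨rfl, rfl⟩⟩
    · exact Pack.nil _
    · refine Pack.small (C := {v}) le_rfl ?_ (by simp) (Pack.nil _)
      rw [Finset.coe_singleton]
      exact SimpleGraph.Connected.of_subsingleton

/-! ### Twins in cographs -/

/-- Any two or more vertices of a cograph include a pair of twins. -/
theorem CographOn.exists_twins {G : SimpleGraph V} {S : Finset V} (h : CographOn G S)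
    {R : Finset V} (hR : R ⊆ S) (hc : 1 < R.card) :
    ∃ u ∈ R, ∃ v ∈ R, u ≠ v ∧ ∀ w ∈ R, w ≠ u → w ≠ v → (G.Adj u w ↔ G.Adj v w) := by
  -- Unions and joins are treated alike: adjacency between A and B is constant. Twins of R inside
  -- one side are therefore not distinguished by the other side; if R has at most one vertex on each
  -- side, no third vertex exists.
  have key : ∀ (A B : Finset V),
      (∀ {R : Finset V}, R ⊆ A → 1 < R.card → ∃ u ∈ R, ∃ v ∈ R, u ≠ v ∧
        ∀ w ∈ R, w ≠ u → w ≠ v → (G.Adj u w ↔ G.Adj v w)) →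
      (∀ {R : Finset V}, R ⊆ B → 1 < R.card → ∃ u ∈ R, ∃ v ∈ R, u ≠ v ∧
        ∀ w ∈ R, w ≠ u → w ≠ v → (G.Adj u w ↔ G.Adj v w)) →
      (∀ a ∈ A, ∀ a' ∈ A, ∀ b ∈ B, ∀ b' ∈ B, (G.Adj a b ↔ G.Adj a' b')) →
      ∀ R ⊆ A ∪ B, 1 < R.card → ∃ u ∈ R, ∃ v ∈ R, u ≠ v ∧
        ∀ w ∈ R, w ≠ u → w ≠ v → (G.Adj u w ↔ G.Adj v w) := by
    intro A B ihA ihB hAB R hR hc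
    by_cases hA : 1 < (R ∩ A).card
    · obtain ⟨u, hu, v, hv, huv, h⟩ := ihA Finset.inter_subset_right hA
      rw [Finset.mem_inter] at hu hv
      refine ⟨u, hu.1, v, hv.1, huv, fun w hw h1 h2 => ?_⟩
      by_cases hwA : w ∈ A
      · exact h w (Finset.mem_inter.2 ⟨hw, hwA⟩) h1 h2
      · have hwB : w ∈ B := by have := hR hw; grind
        exact hAB u hu.2 v hv.2 w hwB w hwB
    by_cases hB : 1 < (R ∩ B).card
    · obtain ⟨u, hu, v, hv, huv, h⟩ := ihB Finset.inter_subset_right hB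
      rw [Finset.mem_inter] at hu hv
      refine ⟨u, hu.1, v, hv.1, huv, fun w hw h1 h2 => ?_⟩
      by_cases hwB : w ∈ B
      · exact h w (Finset.mem_inter.2 ⟨hw, hwB⟩) h1 h2
      · have hwA : w ∈ A := by have := hR hw; grind
        rw [G.adj_comm u w, G.adj_comm v w]
        exact hAB w hwA w hwA u hu.2 v hv.2
    · have h2 : R.card = 2 := by
        have : R.card ≤ (R ∩ A).card + (R ∩ B).card := by
          rw [← Finset.inter_eq_left.2 hR, Finset.inter_assoc, Finset.inter_union_distrib_left]
          refine (Finset.card_union_le _ _).trans ?_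
          apply Nat.add_le_add <;> exact Finset.card_le_card (by grind)
        omega
      obtain ⟨u, v, huv, rfl⟩ := Finset.card_eq_two.1 h2
      exact ⟨u, by simp, v, by simp, huv, fun w hw => by
        simp only [Finset.mem_insert, Finset.mem_singleton] at hw; tauto⟩
  induction h generalizing R with
  | single v =>
    have := Finset.card_le_card hR
    rw [Finset.card_singleton] at this
    omega
  | union A B _ _ _ hAB ihA ihB =>
    exact key A B ihA ihB (fun a ha a' ha' b hb b' hb' =>
      iff_of_false (hAB a ha b hb) (hAB a' ha' b' hb')) R hR hc
  | join A B _ _ _ hAB ihA ihB =>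
    exact key A B ihA ihB (fun a ha a' ha' b hb b' hb' =>
      iff_of_true (hAB a ha b hb) (hAB a' ha' b' hb')) R hR hc

/-! ### Equitable connected partitions as packings -/

theorem Pack.exists_parts {G : SimpleGraph V} {q : ℕ} {S : Finset V} {k s : ℕ}
    (h : Pack G q S k s) : ∃ P : Fin k → Finset V, (∀ i j, i ≠ j → Disjoint (P i) (P j)) ∧
      (∀ i, P i ⊆ S) ∧ (∀ i, (G.induce (P i : Set V)).Connected) ∧
      (∀ i, q ≤ (P i).card ∧ (P i).card ≤ q + 1) ∧ ∑ i, (P i).card = k * q + s := by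
  have key : ∀ {S C : Finset V} {k : ℕ} {P : Fin k → Finset V}, C ⊆ S →
      (∀ i j, i ≠ j → Disjoint (P i) (P j)) → (∀ i, P i ⊆ S \ C) →
      ∀ i j : Fin (k + 1), i ≠ j →
        Disjoint (Fin.cons (α := fun _ => Finset V) C P i)
          (Fin.cons (α := fun _ => Finset V) C P j) := by
    intro S C k P hC hd hP i j hij
    obtain rfl | ⟨i, rfl⟩ := i.eq_zero_or_eq_succ <;> obtain rfl | ⟨j, rfl⟩ := j.eq_zero_or_eq_succ
    · exact absurd rfl hij
    · simpa using Finset.disjoint_sdiff.mono_right (hP j)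
    · simpa using Finset.sdiff_disjoint.mono_left (hP i)
    · simpa using hd i j (by simpa using hij)
  induction h with
  | nil => exact ⟨Fin.elim0, by simp, by simp, by simp, by simp, by simp⟩
  | small hC hc hq _ ih =>
    obtain ⟨P, h1, h2, h3, h4, h5⟩ := ih
    refine ⟨Fin.cons _ P, key hC h1 h2, ?_, ?_, ?_, ?_⟩
    · exact Fin.cases hC fun i => (h2 i).trans Finset.sdiff_subset
    · exact Fin.cases hc h3
    · exact Fin.cases ⟨hq.ge, by simp [hq]⟩ h4
    · simp only [Fin.sum_univ_succ, Fin.cons_zero, Fin.cons_succ, h5, hq]; ring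
  | large hC hc hq _ ih =>
    obtain ⟨P, h1, h2, h3, h4, h5⟩ := ih
    refine ⟨Fin.cons _ P, key hC h1 h2, ?_, ?_, ?_, ?_⟩
    · exact Fin.cases hC fun i => (h2 i).trans Finset.sdiff_subset
    · exact Fin.cases hc h3
    · exact Fin.cases ⟨by simp [hq], hq.le⟩ h4
    · simp only [Fin.sum_univ_succ, Fin.cons_zero, Fin.cons_succ, h5, hq]; ring

/-- Each summand is 0 or 1, so the sum counts the large parts. -/
theorem pack_of_parts {G : SimpleGraph V} {q k : ℕ} {P : Fin k → Finset V} {S : Finset V}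
    (hd : ∀ i j, i ≠ j → Disjoint (P i) (P j)) (hS : ∀ i, P i ⊆ S)
    (hc : ∀ i, (G.induce (P i : Set V)).Connected)
    (hq : ∀ i, q ≤ (P i).card ∧ (P i).card ≤ q + 1) :
    Pack G q S k (∑ i, ((P i).card - q)) := by
  induction k generalizing S with
  | zero => simpa using Pack.nil S
  | succ k ih =>
    have h := ih (P := fun i => P i.succ) (S := S \ P 0)
      (fun i j hij => hd _ _ (by simpa using hij))
      (fun i => Finset.subset_sdiff.2 ⟨hS _, hd _ _ (by simp)⟩) (fun i => hc _) (fun i => hq _)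
    rw [Fin.sum_univ_succ]
    rcases (show (P 0).card = q ∨ (P 0).card = q + 1 by have := hq 0; omega) with h0 | h0
    · simpa [h0] using Pack.small (hS 0) (hc 0) h0 h
    · simpa [h0, Nat.add_comm 1] using Pack.large (hS 0) (hc 0) h0 h

/-- With a the smallest part size, n is p * a plus the number of larger parts, which is below p;
uniqueness of division with remainder gives a = q and r larger parts. Conversely, the parts of the
packing have p * q + r = n vertices in total and so cover everything. -/
theorem isYesInstance_iff_pack {W : Type*} [Fintype W] [DecidableEq W] {G : SimpleGraph W}
    {p q r : ℕ} (hn : Fintype.card W = p * q + r) (hr : r < p) :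
    IsYesInstance G p ↔ Pack G q Finset.univ p r := by
  constructor
  · rintro ⟨P, hd, hcov, hc, he⟩
    have hsum : ∑ i, (P i).card = Fintype.card W := by
      rw [← Finset.card_biUnion fun i _ j _ hij => hd i j hij, ← Finset.card_univ]
      congr 1
      ext v
      simpa using hcov v
    have : Nonempty (Fin p) := ⟨⟨0, by omega⟩⟩
    obtain ⟨i₀, -, hi₀⟩ := Finset.exists_min_image Finset.univ (fun i => (P i).card)
      Finset.univ_nonempty
    set a := (P i₀).card with ha
    have hq : ∀ i, a ≤ (P i).card ∧ (P i).card ≤ a + 1 :=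
      fun i => ⟨hi₀ i (Finset.mem_univ _), he i i₀⟩
    have hp := pack_of_parts hd (fun i => Finset.subset_univ _) hc hq
    have h1 : ∑ i, (P i).card = p * a + ∑ i, ((P i).card - a) := by
      have : ∑ i, (P i).card = ∑ i, (a + ((P i).card - a)) :=
        Finset.sum_congr rfl fun i _ => by have := hq i; omega
      rw [this, Finset.sum_add_distrib]
      simp
    have h2 : ∑ i, ((P i).card - a) < p := by
      calc ∑ i, ((P i).card - a) < ∑ _i : Fin p, 1 :=
            Finset.sum_lt_sum (fun i _ => by have := hq i; omega)
              -- The smallest part contributes 0, which makes the inequality strict.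
              ⟨i₀, Finset.mem_univ _, by simp [ha]⟩
        _ = p := by simp
    have e : p * a + ∑ i, ((P i).card - a) = p * q + r := by omega
    have hp0 : 0 < p := by omega
    have e1 := congrArg (· / p) e
    have e2 := congrArg (· % p) e
    simp only [Nat.mul_add_mod, Nat.mod_eq_of_lt h2, Nat.mod_eq_of_lt hr, Nat.mul_add_div hp0,
      Nat.div_eq_of_lt h2, Nat.div_eq_of_lt hr, Nat.add_zero] at e1 e2
    rwa [e1, ← e1, e2, e1] at hp
  · intro h
    obtain ⟨P, h1, h2, h3, h4, h5⟩ := h.exists_parts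
    refine ⟨P, h1, fun v => ?_, h3, fun i j => ?_⟩
    · have : Finset.univ.biUnion P = Finset.univ := by
        rw [← Finset.card_eq_iff_eq_univ, Finset.card_biUnion fun i _ j _ hij => h1 i j hij, h5, hn]
      simpa using this.ge (Finset.mem_univ v)
    · have := h4 i; have := h4 j; omega

theorem not_isYesInstance_of_card_lt {W : Type*} [Fintype W] {G : SimpleGraph W} {p : ℕ}
    (h : Fintype.card W < p) : ¬ IsYesInstance G p := by
  rintro ⟨P, hd, -, hc, -⟩
  have hne : ∀ i, ∃ v, v ∈ P i := fun i => let ⟨v⟩ := (hc i).nonempty; ⟨v.1, v.2⟩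
  choose f hf using hne
  obtain ⟨i, j, hij, e⟩ := Fintype.exists_ne_map_eq_of_card_lt f (by simpa using h)
  exact Finset.disjoint_left.1 (hd i j hij) (hf i) (e ▸ hf j)


/-! ### Verification of programs -/

/-- Started in memory `m`, the program `c` halts after at most `T` steps in a memory that
satisfies `Q`. -/
def Runs (c : Program) (m : Memory) (T : ℕ) (Q : Memory → Prop) : Prop :=
  ∃ m' t, Exec c m m' t ∧ t ≤ T ∧ Q m'

namespace Runs

variable {c c₁ c₂ : Program} {m : Memory} {T T₁ T₂ : ℕ} {Q Q' : Memory → Prop} {e : Expr}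

theorem mono (h : Runs c m T₁ Q) (hT : T₁ ≤ T) (hQ : ∀ m', Q m' → Q' m') : Runs c m T Q' := by
  obtain ⟨m', t, he, ht, hq⟩ := h
  exact ⟨m', t, he, ht.trans hT, hQ _ hq⟩

theorem seq (h : Runs c₁ m T₁ Q') (h' : ∀ m', Q' m' → Runs c₂ m' T₂ Q) (hT : T₁ + T₂ ≤ T) :
    Runs (.seq c₁ c₂) m T Q := by
  obtain ⟨m', t, he, ht, hq⟩ := h
  obtain ⟨m'', t', he', ht', hq'⟩ := h' m' hq
  exact ⟨m'', t + t', .seq he he', by omega, hq'⟩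

theorem cond (h₁ : e.eval m ≠ 0 → Runs c₁ m T₁ Q) (h₂ : e.eval m = 0 → Runs c₂ m T₁ Q)
    (hT : e.cost + 1 + T₁ ≤ T) : Runs (.cond e c₁ c₂) m T Q := by
  by_cases h : e.eval m = 0
  · obtain ⟨m', t, he, ht, hq⟩ := h₂ h
    exact ⟨m', _, .cond_false h he, by omega, hq⟩
  · obtain ⟨m', t, he, ht, hq⟩ := h₁ h
    exact ⟨m', _, .cond_true h he, by omega, hq⟩

/-- A loop whose body decreases the measure `f` as long as the condition holds. -/
theorem loop {Inv : Memory → Prop} (f : Memory → ℕ) (h₀ : Inv m)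
    (hstep : ∀ m, Inv m → e.eval m ≠ 0 → Runs c m T (fun m' => Inv m' ∧ f m' < f m)) :
    Runs (.loop e c) m (f m * (T + e.cost + 1) + e.cost + 1)
      (fun m' => Inv m' ∧ e.eval m' = 0) := by
  induction hk : f m using Nat.strong_induction_on generalizing m with
  | _ k ih =>
    subst hk
    by_cases h : e.eval m = 0
    · exact ⟨m, _, .loop_false h, by omega, h₀, h⟩
    · obtain ⟨m', t, he, ht, hI, hlt⟩ := hstep m h₀ h
      obtain ⟨m'', t', he', ht', hq⟩ := ih _ hlt hI rfl
      refine ⟨m'', _, .loop_true h he he', ?_, hq⟩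
      have : (f m' + 1) * (T + e.cost + 1) ≤ f m * (T + e.cost + 1) := Nat.mul_le_mul_right _ hlt
      rw [Nat.succ_mul] at this
      omega

end Runs

/-- Programs without loops. -/
def Program.isStraight : Program → Bool
  | .seq c₁ c₂ => c₁.isStraight && c₂.isStraight
  | .cond _ c₁ c₂ => c₁.isStraight && c₂.isStraight
  | .loop _ _ => false
  | _ => true

/-- The memory after a run of a program without loops. -/
def Program.run : Program → Memory → Memory
  | .skip, m => m
  | .assign i e, m => { m with reg := Function.update m.reg i (e.eval m) }
  | .put a e₁ e₂, m =>
    { m with arr := Function.update m.arr a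
               (Function.update (m.arr a) (e₁.eval m) (e₂.eval m)) }
  | .seq c₁ c₂, m => c₂.run (c₁.run m)
  | .cond e c₁ c₂, m => if e.eval m = 0 then c₂.run m else c₁.run m
  | .loop _ _, m => m

theorem Program.run_cond_of_eq_zero {e : Expr} {m : Memory} (h : e.eval m = 0)
    (c₁ c₂ : Program) : (cond e c₁ c₂).run m = c₂.run m :=
  if_pos h

theorem Program.run_cond_of_ne_zero {e : Expr} {m : Memory} (h : e.eval m ≠ 0)
    (c₁ c₂ : Program) : (cond e c₁ c₂).run m = c₁.run m :=
  if_neg h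

/-- A bound for the running time of a program without loops. -/
def Program.cost : Program → ℕ
  | .skip => 1
  | .assign _ e => e.cost + 1
  | .put _ e₁ e₂ => e₁.cost + e₂.cost + 1
  | .seq c₁ c₂ => c₁.cost + c₂.cost
  | .cond e c₁ c₂ => e.cost + 1 + (c₁.cost + c₂.cost)
  | .loop _ _ => 0

theorem Program.runs_run {c : Program} (hc : c.isStraight = true) (m : Memory) :
    Runs c m c.cost (fun m' => m' = c.run m) := by
  induction c generalizing m with
  | skip => exact ⟨_, _, .skip m, le_rfl, rfl⟩
  | assign i e => exact ⟨_, _, .assign m i e, le_rfl, rfl⟩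
  | put a e₁ e₂ => exact ⟨_, _, .put m a e₁ e₂, le_rfl, rfl⟩
  | seq c₁ c₂ ih₁ ih₂ =>
    simp only [isStraight, Bool.and_eq_true] at hc
    exact (ih₁ hc.1 m).seq (fun m' h => (ih₂ hc.2 m').mono le_rfl fun _ h' => by rw [h', h, run])
      le_rfl
  | cond e c₁ c₂ ih₁ ih₂ =>
    simp only [isStraight, Bool.and_eq_true] at hc
    refine Runs.cond (T₁ := c₁.cost + c₂.cost) (fun h => ?_) (fun h => ?_) le_rfl
    · exact (ih₁ hc.1 m).mono (by omega) fun _ h' => by rw [h', run, if_neg h]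
    · exact (ih₂ hc.2 m).mono (by omega) fun _ h' => by rw [h', run, if_pos h]
  | loop => simp [isStraight] at hc

/-- Reduces loop-free code to evaluating a function and a numeral bound; branches of a conditional
are both charged, which costs only a constant. -/
theorem Runs.straight {c : Program} {m : Memory} {T : ℕ} {Q : Memory → Prop}
    (hc : c.isStraight = true) (hT : c.cost ≤ T) (hQ : Q (c.run m)) : Runs c m T Q :=
  (c.runs_run hc m).mono hT fun _ h => h ▸ hQ

/-- Runs `c` for the values `0, 1, …` below `e` of register `i`. -/
def forLoop (i : ℕ) (e : Expr) (c : Program) : Program :=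
  .seq (.assign i (.const 0))
    (.loop (.sub e (.reg i)) (.seq c (.assign i (.add (.reg i) (.const 1)))))

/-- `hreg` forces the invariant to track the counter and the bound. Per iteration the test costs
`e.cost + 3` and the increment 4; initialisation and the last test give the final `e.cost + 5`. -/
theorem Runs.forLoop {i : ℕ} {e : Expr} {c : Program} {m : Memory} {N T T' : ℕ}
    {Inv : ℕ → Memory → Prop} {Q : Memory → Prop}
    (h₀ : Inv 0 { m with reg := Function.update m.reg i 0 })
    (hreg : ∀ j m, Inv j m → m.reg i = j ∧ e.eval m = N)
    (hstep : ∀ j < N, ∀ m, Inv j m → Runs c m T (fun m' =>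
      Inv (j + 1) { m' with reg := Function.update m'.reg i (m'.reg i + 1) }))
    (hT : N * (T + e.cost + 7) + e.cost + 5 ≤ T')
    (hQ : ∀ m', Inv N m' → Q m') :
    Runs (forLoop i e c) m T' Q := by
  refine Runs.seq (T₁ := 2) (Q' := fun m' => ∃ j ≤ N, Inv j m' ∧ m'.reg i = 0)
    (.straight rfl (by simp [Program.cost, Expr.cost])
      ⟨0, Nat.zero_le _, h₀, by simp [Program.run, Expr.eval]⟩)
    (T₂ := N * (T + e.cost + 7) + e.cost + 3) (fun m' hm' => ?_) (by omega)
  obtain ⟨j, hj, hm', hi⟩ := hm'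
  refine (Runs.loop (Inv := fun m => ∃ j ≤ N, Inv j m) (T := T + 4) (fun m => N - m.reg i)
    ⟨j, hj, hm'⟩ ?_).mono ?_ ?_
  · rintro m ⟨j, hj, hm⟩ he
    obtain ⟨h1, h2⟩ := hreg j m hm
    have hlt : j < N := by simp only [Expr.eval] at he; omega
    refine (hstep j hlt m hm).seq (T₂ := 4) (fun m' hm' =>
      .straight rfl (by simp [Program.cost, Expr.cost]) ⟨⟨j + 1, hlt, hm'⟩, ?_⟩) le_rfl
    have := (hreg _ _ hm').1
    simp only [Program.run, Expr.eval, Function.update_self] at this ⊢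
    omega
  · simp only [hi, Expr.cost, Nat.sub_zero]
    rw [show T + 4 + (e.cost + 1 + 1) + 1 = T + e.cost + 7 by ring]
    omega
  · rintro m ⟨⟨j, hj, hm⟩, he⟩
    obtain ⟨h1, h2⟩ := hreg j m hm
    obtain rfl : j = N := by simp only [Expr.eval] at he; omega
    exact hQ m hm

/-! ### The program -/

/-- The truth value of `e₁ ≠ e₂`. -/
def Expr.diff (e₁ e₂ : Expr) : Expr := .add (.sub e₁ e₂) (.sub e₂ e₁)

theorem Expr.eval_diff_eq_zero {e₁ e₂ : Expr} {m : Memory} :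
    (e₁.diff e₂).eval m = 0 ↔ e₁.eval m = e₂.eval m := by
  simp only [diff, eval]; omega

/-- The minimum of two expressions. -/
def Expr.min (e₁ e₂ : Expr) : Expr := .sub e₁ (.sub e₁ e₂)

theorem Expr.eval_min {e₁ e₂ : Expr} {m : Memory} :
    (e₁.min e₂).eval m = Min.min (e₁.eval m) (e₂.eval m) := by
  simp only [Expr.min, eval]; omega

/-- The maximum of two expressions. -/
def Expr.max (e₁ e₂ : Expr) : Expr := .add e₁ (.sub e₂ e₁)

theorem Expr.eval_max {e₁ e₂ : Expr} {m : Memory} :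
    (e₁.max e₂).eval m = Max.max (e₁.eval m) (e₂.eval m) := by
  simp only [Expr.max, eval]; omega

/-! Registers: `0`: `n`; `1`: `p`; `2`: quotient `q` and `3`: remainder `r` of `n` by `p`; `4`: the
first free address of array `2`; `5`: counter of rounds; `6`, `7`: candidate pair; `8`: third
vertex; `9`: number of obstructions; `10`, `11`: pair of twins; `12`, `13`: numbers of parts;
`14`: new table entry; `15`: `q` times register `12`.

Arrays: `0`: adjacency matrix; `1`: offsets of its rows; `2`: tables; `3`: addresses of the tables;
`4`: marks of the deleted vertices; `5`: sizes of modules. -/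

/-- Adds to register `9` the obstruction that vertex `8` presents to `6` and `7` being twins. -/
def compareAt : Program :=
  .cond (.get 4 (.reg 8)) .skip
    (.cond (.diff (.reg 8) (.reg 6))
      (.cond (.diff (.reg 8) (.reg 7))
        (.assign 9 (.add (.reg 9) (.diff (.get 0 (.add (.get 1 (.reg 6)) (.reg 8)))
          (.get 0 (.add (.get 1 (.reg 7)) (.reg 8))))))
        .skip)
      .skip)

/-- Records `6` and `7` as registers `10` and `11` if they are twins. -/
def checkPair : Program :=
  .seq (.assign 9 (.add (.get 4 (.reg 6)) (.get 4 (.reg 7))))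
    (.seq (forLoop 8 (.reg 0) compareAt)
      (.cond (.reg 9) .skip (.seq (.assign 10 (.reg 6)) (.assign 11 (.reg 7)))))

/-- Finds a pair of twins. -/
def findTwins : Program := forLoop 6 (.reg 0) (forLoop 7 (.reg 6) checkPair)

/-- One step of the computation of a table entry for a disjoint union. -/
def unionStep : Program :=
  .cond (.get 2 (.add (.get 3 (.reg 10)) (.reg 13)))
    (.cond (.get 2 (.add (.get 3 (.reg 11)) (.sub (.reg 12) (.reg 13))))
      (.assign 14 (.max (.reg 14) (.sub (.add (.get 2 (.add (.get 3 (.reg 10)) (.reg 13)))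
        (.get 2 (.add (.get 3 (.reg 11)) (.sub (.reg 12) (.reg 13))))) (.const 1))))
      .skip)
    .skip

/-- The entry of number `12` in the table of a disjoint union. -/
def unionEntry : Program :=
  .seq (.assign 14 (.const 0)) (forLoop 13 (.add (.reg 12) (.const 1)) unionStep)

/-- The entry of number `12` in the table of a complete join. -/
def joinEntry : Program :=
  .seq (.assign 14 (.const 0))
    (.cond (.get 2 (.add (.get 3 (.reg 10)) (.sub (.reg 12) (.get 5 (.reg 11)))))
      (.cond (.get 2 (.add (.get 3 (.reg 11)) (.sub (.reg 12) (.get 5 (.reg 10)))))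
        (.assign 14
          (.min (.add (.reg 12) (.const 1))
            (.min (.sub (.add (.add (.get 5 (.reg 10)) (.get 5 (.reg 11))) (.const 1)) (.reg 15))
              (.min
                (.add (.get 2 (.add (.get 3 (.reg 10)) (.sub (.reg 12) (.get 5 (.reg 11)))))
                  (.get 5 (.reg 11)))
                (.add (.get 2 (.add (.get 3 (.reg 11)) (.sub (.reg 12) (.get 5 (.reg 10)))))
                  (.get 5 (.reg 10)))))))
        .skip)
      .skip)

/-- Computes and stores one entry of the table of the merged module. -/
def entryStep : Program :=
  .seq (.cond (.get 0 (.add (.get 1 (.reg 10)) (.reg 11))) joinEntry unionEntry)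
    (.seq (.put 2 (.add (.reg 4) (.reg 12)) (.reg 14))
      (.assign 15 (.add (.reg 15) (.reg 2))))

/-- Updates the data about the vertices `10` and `11` after the new table is complete. -/
def relabel : Program :=
  .seq (.put 3 (.reg 10) (.reg 4))
    (.seq (.assign 4 (.add (.reg 4) (.add (.reg 0) (.const 1))))
      (.seq (.put 4 (.reg 11) (.const 1))
        (.put 5 (.reg 10) (.add (.get 5 (.reg 10)) (.get 5 (.reg 11))))))

/-- Merges the module of vertex `11` into the one of its twin `10`. -/
def mergeTwins : Program :=
  .seq (.assign 15 (.const 0))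
    (.seq (forLoop 12 (.add (.reg 0) (.const 1)) entryStep) relabel)

/-- Divides `n` by `p`. -/
def divide : Program :=
  .seq (.assign 3 (.reg 0))
    (.loop (.sub (.add (.reg 3) (.const 1)) (.reg 1))
      (.seq (.assign 3 (.sub (.reg 3) (.reg 1))) (.assign 2 (.add (.reg 2) (.const 1)))))

/-- Sets up the data about vertex `5`. -/
def setupVertex : Program :=
  .seq (.put 1 (.reg 5) (.reg 12))
    (.seq (.assign 12 (.add (.reg 12) (.reg 0)))
      (.seq (.put 3 (.reg 5) (.reg 4))
        (.seq (.put 5 (.reg 5) (.const 1))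
          (.seq (.put 2 (.reg 4) (.const 1))
            -- Entries count feasible s: for one vertex entry 0 is 1, and entry 1 is 1 only when q =
            -- 1. Unwritten cells are 0, meaning infeasible.
            (.seq (.cond (.sub (.reg 2) (.const 1)) .skip
                (.put 2 (.add (.reg 4) (.const 1)) (.const 1)))
              (.assign 4 (.add (.reg 4) (.add (.reg 0) (.const 1)))))))))

/-- Reads the answer from the table of the last vertex. -/
def answer : Program :=
  .cond (.sub (.get 2 (.add (.get 3 (.sub (.reg 0) (.const 1))) (.reg 1))) (.reg 3))
    (.assign 0 (.const 1)) (.assign 0 (.const 0))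

/-- The program that solves the problem on cographs. -/
def solver : Program :=
  .cond (.sub (.reg 1) (.reg 0)) (.assign 0 (.const 0))
    (.seq divide
      (.seq (forLoop 5 (.reg 0) setupVertex)
        (.seq (forLoop 5 (.sub (.reg 0) (.const 1)) (.seq findTwins mergeTwins)) answer)))


/-! ### The search for twins -/

/-- The vertex `w` does not distinguish `u` from `v`, according to the arrays `arr`. -/
def Agree (arr : ℕ → ℕ → ℕ) (u v w : ℕ) : Prop :=
  arr 4 w = 0 → w ≠ u → w ≠ v → arr 0 (arr 1 u + w) = arr 0 (arr 1 v + w)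

/-- The vertices `u` and `v` are undeleted twins, according to the arrays `arr`. -/
def Twins (arr : ℕ → ℕ → ℕ) (n u v : ℕ) : Prop :=
  arr 4 u = 0 ∧ arr 4 v = 0 ∧ ∀ w < n, Agree arr u v w

theorem runs_compareAt (m : Memory) : Runs compareAt m 60 (fun m' => m'.arr = m.arr ∧
    (∀ i, i ≠ 9 → m'.reg i = m.reg i) ∧
    (m'.reg 9 = 0 ↔ m.reg 9 = 0 ∧ Agree m.arr (m.reg 6) (m.reg 7) (m.reg 8))) := by
  refine .straight rfl (by decide) ?_
  simp only [compareAt, Program.run, Expr.eval_diff_eq_zero, Agree]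
  split_ifs with h1 h2 h3
  · simp only [Expr.eval] at h1 h2
    simp [h2]
  · simp only [Expr.eval] at h1 h2 h3
    simp [h3]
  · simp only [Expr.eval] at h1 h2 h3
    refine ⟨rfl, fun i hi => by simp [hi], ?_⟩
    simp only [Function.update_self, Expr.eval, Nat.add_eq_zero_iff, Expr.diff, h1, ne_eq, h2, h3,
      not_false_eq_true, forall_const]
    omega
  · simp only [Expr.eval] at h1
    simp [h1]

theorem runs_checkPair {m : Memory} {n : ℕ} (hn : m.reg 0 = n) :
    Runs checkPair m (n * 70 + 40) (fun m' => m'.arr = m.arr ∧ (∀ i < 8, m'.reg i = m.reg i) ∧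
      (Twins m.arr n (m.reg 6) (m.reg 7) → m'.reg 10 = m.reg 6 ∧ m'.reg 11 = m.reg 7) ∧
      (¬ Twins m.arr n (m.reg 6) (m.reg 7) → m'.reg 10 = m.reg 10 ∧ m'.reg 11 = m.reg 11)) := by
  refine Runs.seq (T₁ := 10) (Q' := fun m' => m'.arr = m.arr ∧ (∀ i, i ≠ 9 → m'.reg i = m.reg i) ∧
    m'.reg 9 = m.arr 4 (m.reg 6) + m.arr 4 (m.reg 7)) (T₂ := n * 70 + 30) ?_ ?_ (by omega)
  · refine .straight rfl (by decide) ⟨rfl, fun i hi => ?_, ?_⟩ <;>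
      simp_all [Program.run, Expr.eval]
  rintro m₁ ⟨ha, hr, h9⟩
  refine Runs.seq (T₁ := n * 70 + 6) (T₂ := 24) (Q' := fun m' => m'.arr = m.arr ∧
    (∀ i, i ≠ 8 → i ≠ 9 → m'.reg i = m.reg i) ∧
    (m'.reg 9 = 0 ↔ Twins m.arr n (m.reg 6) (m.reg 7))) ?_ ?_ (by omega)
  · refine Runs.forLoop (N := n) (T := 60) (Inv := fun j m' => m'.arr = m.arr ∧ m'.reg 8 = j ∧
      (∀ i, i ≠ 8 → i ≠ 9 → m'.reg i = m.reg i) ∧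
      (m'.reg 9 = 0 ↔ m.arr 4 (m.reg 6) = 0 ∧ m.arr 4 (m.reg 7) = 0 ∧
        ∀ w < j, Agree m.arr (m.reg 6) (m.reg 7) w)) ?_ ?_ ?_ ?_ ?_
    · refine ⟨ha, by simp, fun i h8 h9 => by simp [h8, hr i h9], ?_⟩
      simp [h9]
    · rintro j m' ⟨-, h8, h, -⟩
      exact ⟨h8, by simp only [Expr.eval]; rw [h 0 (by decide) (by decide), hn]⟩
    · rintro j hj m' ⟨ha', h8, h, h9'⟩
      refine (runs_compareAt m').mono le_rfl ?_
      rintro m'' ⟨ha'', h'', h9''⟩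
      refine ⟨ha''.trans ha', ?_, fun i hi8 hi9 => ?_, ?_⟩
      · simp [h'' 8, h8]
      · simp [hi8, h'' i hi9, h i hi8 hi9]
      · simp only [ne_eq, not_false_eq_true, Function.update_of_ne,
          Nat.reduceEqDiff, h9'', h9', ha', h 6 (by decide) (by decide),
          h 7 (by decide) (by decide), h8]
        constructor
        · rintro ⟨⟨h1, h2, h3⟩, h4⟩
          refine ⟨h1, h2, fun w hw => ?_⟩
          rcases Nat.lt_succ_iff_lt_or_eq.1 hw with hw | rfl
          · exact h3 w hw
          · exact h4
        · rintro ⟨h1, h2, h3⟩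
          exact ⟨⟨h1, h2, fun w hw => h3 w (by omega)⟩, h3 j (by omega)⟩
    · simp only [Expr.cost]; omega
    · rintro m' ⟨h1, -, h2, h3⟩
      exact ⟨h1, h2, h3⟩
  · rintro m₂ ⟨ha₂, hr₂, h9₂⟩
    refine .straight rfl (by decide) ?_
    by_cases h : Twins m.arr n (m.reg 6) (m.reg 7)
    · rw [Program.run_cond_of_eq_zero (e := .reg 9) (h9₂.2 h)]
      simp only [Program.run, Expr.eval]
      refine ⟨ha₂, fun i hi => ?_, fun _ => ?_, fun h' => absurd h h'⟩
      · have h1 : i ≠ 11 := by omega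
        have h2 : i ≠ 10 := by omega
        simp [h1, h2, hr₂ i (by omega) (by omega)]
      · simp [hr₂]
    · rw [Program.run_cond_of_ne_zero (e := .reg 9) (mt h9₂.1 h)]
      exact ⟨ha₂, fun i hi => hr₂ i (by omega) (by omega), fun h' => absurd h' h,
        fun _ => ⟨hr₂ 10 (by decide) (by decide), hr₂ 11 (by decide) (by decide)⟩⟩

/-- The pair is recorded with the smaller vertex in register 11, the one to be deleted. A later pair
may overwrite an earlier one. -/
theorem runs_findTwins {m : Memory} {n : ℕ} (hn : m.reg 0 = n) :
    Runs findTwins m (n * (n * (n * 70 + 48) + 14) + 6) (fun m' => m'.arr = m.arr ∧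
      (∀ i < 6, m'.reg i = m.reg i) ∧ ((∃ u < n, ∃ v < u, Twins m.arr n u v) →
        m'.reg 11 < m'.reg 10 ∧ m'.reg 10 < n ∧ Twins m.arr n (m'.reg 10) (m'.reg 11))) := by
  set Good : Memory → Prop := fun m' =>
    m'.reg 11 < m'.reg 10 ∧ m'.reg 10 < n ∧ Twins m.arr n (m'.reg 10) (m'.reg 11) with hGood
  have hcongr : ∀ m' i x, i < 8 → (Good { m' with reg := Function.update m'.reg i x } ↔ Good m') := by
    intro m' i x hi
    have h1 : 10 ≠ i := by omega
    have h2 : 11 ≠ i := by omega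
    simp [hGood, h1, h2]
  refine Runs.forLoop (N := n) (T := n * (n * 70 + 48) + 6) (Inv := fun j m' => m'.arr = m.arr ∧
    m'.reg 6 = j ∧ (∀ i < 6, m'.reg i = m.reg i) ∧
    ((∃ u < j, ∃ v < u, Twins m.arr n u v) → Good m')) ?_ ?_ ?_ ?_ ?_
  · refine ⟨rfl, by simp, fun i hi => ?_, ?_⟩
    · have : i ≠ 6 := by omega
      simp [this]
    · rintro ⟨u, hu, -⟩; omega
  · rintro j m' ⟨-, h6, h, -⟩
    exact ⟨h6, by simp only [Expr.eval]; rw [h 0 (by decide), hn]⟩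
  · rintro u hu m₁ ⟨ha₁, h6₁, hr₁, hg₁⟩
    refine Runs.forLoop (N := u) (T := n * 70 + 40) (Inv := fun j m' => m'.arr = m.arr ∧
      m'.reg 7 = j ∧ m'.reg 6 = u ∧ (∀ i < 6, m'.reg i = m.reg i) ∧
      (((∃ u' < u, ∃ v < u', Twins m.arr n u' v) ∨ ∃ v < j, Twins m.arr n u v) → Good m'))
      ?_ ?_ ?_ ?_ ?_
    · refine ⟨ha₁, by simp, by simp [h6₁], fun i hi => ?_, ?_⟩
      · have : i ≠ 7 := by omega
        simp [this, hr₁ i hi]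
      · rintro (h | ⟨v, hv, -⟩)
        · rw [hcongr _ _ _ (by decide)]; exact hg₁ h
        · omega
    · rintro j m' ⟨-, h7, h6, -, -⟩
      exact ⟨h7, h6⟩
    · rintro v hv m₂ ⟨ha₂, h7₂, h6₂, hr₂, hg₂⟩
      refine (runs_checkPair (n := n) (by rw [hr₂ 0 (by decide), hn])).mono le_rfl ?_
      rintro m₃ ⟨ha₃, hr₃, h1, h2⟩
      rw [ha₂, h6₂, h7₂] at h1 h2
      refine ⟨ha₃.trans ha₂, ?_, ?_, fun i hi => ?_, ?_⟩
      · simp [hr₃ 7, h7₂]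
      · simp [hr₃ 6, h6₂]
      · have : i ≠ 7 := by omega
        simp [this, hr₃ i (by omega), hr₂ i hi]
      · intro h
        rw [hcongr _ _ _ (by decide)]
        by_cases ht : Twins m.arr n u v
        · obtain ⟨e1, e2⟩ := h1 ht
          simp only [hGood, e1, e2]
          exact ⟨hv, hu, ht⟩
        · obtain ⟨e1, e2⟩ := h2 ht
          have := hg₂ (h.imp_right fun ⟨v', hv', ht'⟩ => ⟨v', by
            rcases Nat.lt_succ_iff_lt_or_eq.1 hv' with h | rfl
            · exact h
            · exact absurd ht' ht, ht'⟩)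
          simpa only [hGood, e1, e2] using this
    · have : u * (n * 70 + 40 + 1 + 7) ≤ n * (n * 70 + 48) := Nat.mul_le_mul hu.le (by omega)
      simp only [Expr.cost]
      omega
    · rintro m' ⟨ha', h7, h6, hr, hg⟩
      refine ⟨ha', by simp [h6], fun i hi => ?_, ?_⟩
      · have : i ≠ 6 := by omega
        simp [this, hr i hi]
      · rintro ⟨u', hu', v, hv, ht⟩
        rw [hcongr _ _ _ (by decide)]
        rcases Nat.lt_succ_iff_lt_or_eq.1 hu' with h | rfl
        · exact hg (Or.inl ⟨u', h, v, hv, ht⟩)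
        · exact hg (Or.inr ⟨v, hv, ht⟩)
  · simp only [Expr.cost]
    exact le_rfl
  · rintro m' ⟨h1, -, h2, h3⟩
    exact ⟨h1, h2, h3⟩

/-! ### The tables -/

/-- The values below the `k`-th entry in the table of a disjoint union of modules with tables `f`
and `g`. -/
def UnionCell (f g : ℕ → ℕ) (k s : ℕ) : Prop :=
  ∃ k₁ ≤ k, ∃ s₁ s₂, s₁ + s₂ = s ∧ s₁ < f k₁ ∧ s₂ < g (k - k₁)

/-- The values below the `k`-th entry in the table of a complete join of modules with sizes `a`
and `b` and tables `f` and `g`. -/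
def JoinCell (f g : ℕ → ℕ) (a b q k s : ℕ) : Prop :=
  s ≤ k ∧ k * q + s ≤ a + b ∧ s - b < f (k - b) ∧ s - a < g (k - a)

/-- Entries f and g stand for the values below them, so sums reach (f - 1) + (g - 1) and the count
is f + g - 1, provided that neither entry is 0. -/
theorem runs_unionStep {m : Memory} {f g : ℕ} (hf : m.arr 2 (m.arr 3 (m.reg 10) + m.reg 13) = f)
    (hg : m.arr 2 (m.arr 3 (m.reg 11) + (m.reg 12 - m.reg 13)) = g) :
    Runs unionStep m 60 (fun m' => m'.arr = m.arr ∧ (∀ i, i ≠ 14 → m'.reg i = m.reg i) ∧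
      ∀ s, s < m'.reg 14 ↔ s < m.reg 14 ∨ ∃ s₁ s₂, s₁ + s₂ = s ∧ s₁ < f ∧ s₂ < g) := by
  have key : ∀ s, (∃ s₁ s₂, s₁ + s₂ = s ∧ s₁ < f ∧ s₂ < g) ↔ f ≠ 0 ∧ g ≠ 0 ∧ s < f + g - 1 := by
    intro s
    constructor
    · rintro ⟨s₁, s₂, h⟩; omega
    · intro h
      exact ⟨min s (f - 1), s - min s (f - 1), by omega⟩
  refine .straight rfl (by decide) ?_
  simp only [unionStep, Program.run, Expr.eval_max, Expr.eval, hf, hg, key]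
  split_ifs with h1 h2
  · simp [h1]
  · simp [h2]
  · refine ⟨rfl, fun i hi => by simp [hi], fun s => ?_⟩
    simp only [Function.update_self]
    omega

theorem runs_unionEntry {m : Memory} {k : ℕ} {f g : ℕ → ℕ} (hk : m.reg 12 = k)
    (hf : ∀ i ≤ k, m.arr 2 (m.arr 3 (m.reg 10) + i) = f i)
    (hg : ∀ i ≤ k, m.arr 2 (m.arr 3 (m.reg 11) + i) = g i) :
    Runs unionEntry m (k * 70 + 80) (fun m' => m'.arr = m.arr ∧
      (∀ i, i ≠ 13 → i ≠ 14 → m'.reg i = m.reg i) ∧ ∀ s, s < m'.reg 14 ↔ UnionCell f g k s) := by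
  refine Runs.seq (T₁ := 2) (Q' := fun m' => m'.arr = m.arr ∧
    (∀ i, i ≠ 14 → m'.reg i = m.reg i) ∧ m'.reg 14 = 0) (T₂ := k * 70 + 78) ?_ ?_ (by omega)
  · refine .straight rfl (by decide) ⟨rfl, fun i hi => ?_, ?_⟩ <;>
      simp_all [Program.run, Expr.eval]
  rintro m₁ ⟨ha, hr, h14⟩
  refine Runs.forLoop (N := k + 1) (T := 60) (Inv := fun j m' => m'.arr = m.arr ∧ m'.reg 13 = j ∧
    (∀ i, i ≠ 13 → i ≠ 14 → m'.reg i = m.reg i) ∧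
    ∀ s, s < m'.reg 14 ↔ ∃ k₁ < j, ∃ s₁ s₂, s₁ + s₂ = s ∧ s₁ < f k₁ ∧ s₂ < g (k - k₁))
    ?_ ?_ ?_ ?_ ?_
  · exact ⟨ha, by simp, fun i h13 h14 => by simp [h13, hr i h14], by simp [h14]⟩
  · rintro j m' ⟨-, h13, h, -⟩
    exact ⟨h13, by simp only [Expr.eval]; rw [h 12 (by decide) (by decide), hk]⟩
  · rintro j hj m' ⟨ha', h13, h, hs⟩
    refine (runs_unionStep (f := f j) (g := g (k - j)) ?_ ?_).mono le_rfl ?_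
    · rw [ha', h13, h 10 (by decide) (by decide)]; exact hf j (by omega)
    · rw [ha', h13, h 11 (by decide) (by decide), h 12 (by decide) (by decide), hk]
      exact hg _ (by omega)
    · rintro m'' ⟨ha'', hr'', hs''⟩
      refine ⟨ha''.trans ha', by simp [hr'', h13], fun i hi hi' => ?_, fun s => ?_⟩
      · simp [hi, hr'' i hi', h i hi hi']
      · simp only [ne_eq, not_false_eq_true, Function.update_of_ne,
          Nat.reduceEqDiff, hs'', hs]
        constructor
        · rintro (⟨k₁, h1, h2⟩ | h2)
          · exact ⟨k₁, by omega, h2⟩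
          · exact ⟨j, by omega, h2⟩
        · rintro ⟨k₁, h1, h2⟩
          rcases Nat.lt_succ_iff_lt_or_eq.1 h1 with h | rfl
          · exact Or.inl ⟨k₁, h, h2⟩
          · exact Or.inr h2
  · simp only [Expr.cost]; omega
  · rintro m' ⟨h1, -, h2, h3⟩
    refine ⟨h1, h2, fun s => (h3 s).trans ?_⟩
    simp only [UnionCell, Nat.lt_succ_iff]

/-- Each condition on s is an upper bound, so the entry is a minimum. With truncated subtraction, s
- b < f amounts to s < f + b only for f ≠ 0, hence the two tests. -/
theorem runs_joinEntry {m : Memory} {k q a b : ℕ} {f g : ℕ → ℕ} (hk : m.reg 12 = k)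
    (hq : m.reg 15 = k * q) (ha : m.arr 5 (m.reg 10) = a) (hb : m.arr 5 (m.reg 11) = b)
    (hf : ∀ i ≤ k, m.arr 2 (m.arr 3 (m.reg 10) + i) = f i)
    (hg : ∀ i ≤ k, m.arr 2 (m.arr 3 (m.reg 11) + i) = g i) :
    Runs joinEntry m 120 (fun m' => m'.arr = m.arr ∧
      (∀ i, i ≠ 13 → i ≠ 14 → m'.reg i = m.reg i) ∧
      ∀ s, s < m'.reg 14 ↔ JoinCell f g a b q k s) := by
  have hf' := hf (k - b) (by omega)
  have hg' := hg (k - a) (by omega)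
  refine .straight rfl (by decide) ?_
  simp only [joinEntry, Program.run, Expr.eval_min, Expr.eval, Function.update_apply,
    Nat.reduceEqDiff, if_false, hk, hq, ha, hb, hf', hg', JoinCell]
  split_ifs with h1 h2
  · refine ⟨rfl, fun i _ hi => by simp [hi], fun s => ?_⟩
    simp [h1]
  · refine ⟨rfl, fun i _ hi => by simp [hi], fun s => ?_⟩
    simp [h2]
  · refine ⟨rfl, fun i _ hi => by simp [hi], fun s => ?_⟩
    simp only [Function.update_self]
    omega

/-- The values below the `k`-th entry in the table of the union of the modules of the vertices
`x` and `y`, computed from the arrays `arr`. -/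
def Cell (arr : ℕ → ℕ → ℕ) (q x y k s : ℕ) : Prop :=
  (arr 0 (arr 1 x + y) ≠ 0 → JoinCell (fun i => arr 2 (arr 3 x + i)) (fun i => arr 2 (arr 3 y + i))
    (arr 5 x) (arr 5 y) q k s) ∧
  (arr 0 (arr 1 x + y) = 0 →
    UnionCell (fun i => arr 2 (arr 3 x + i)) (fun i => arr 2 (arr 3 y + i)) k s)

theorem runs_entry {m : Memory} {arr : ℕ → ℕ → ℕ} {k q x y : ℕ} (hk : m.reg 12 = k)
    (hq : m.reg 15 = k * q) (hx : m.reg 10 = x) (hy : m.reg 11 = y)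
    (harr : ∀ i, i ≠ 2 → m.arr i = arr i)
    (hf : ∀ i ≤ k, m.arr 2 (arr 3 x + i) = arr 2 (arr 3 x + i))
    (hg : ∀ i ≤ k, m.arr 2 (arr 3 y + i) = arr 2 (arr 3 y + i)) :
    Runs (.cond (.get 0 (.add (.get 1 (.reg 10)) (.reg 11))) joinEntry unionEntry) m
      (k * 70 + 130) (fun m' => m'.arr = m.arr ∧
      (∀ i, i ≠ 13 → i ≠ 14 → m'.reg i = m.reg i) ∧
      ∀ s, s < m'.reg 14 ↔ Cell arr q x y k s) := by
  refine Runs.cond (T₁ := k * 70 + 120) (fun h => ?_) (fun h => ?_) ?_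
  · refine (runs_joinEntry (f := fun i => arr 2 (arr 3 x + i)) (g := fun i => arr 2 (arr 3 y + i))
      hk hq rfl rfl ?_ ?_).mono (by omega) fun m' ⟨h1, h2, h3⟩ => ⟨h1, h2, fun s => ?_⟩
    · simpa only [hx, harr 3 (by decide)] using hf
    · simpa only [hy, harr 3 (by decide)] using hg
    · simp only [Expr.eval, hx, hy, harr 0 (by decide), harr 1 (by decide)] at h
      simp only [h3 s, Cell, hx, hy, harr 5 (by decide), ne_eq, h, not_false_eq_true, forall_const,
        false_imp_iff, and_true]
  · refine (runs_unionEntry (f := fun i => arr 2 (arr 3 x + i)) (g := fun i => arr 2 (arr 3 y + i))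
      hk ?_ ?_).mono (by omega) fun m' ⟨h1, h2, h3⟩ => ⟨h1, h2, fun s => ?_⟩
    · simpa only [hx, harr 3 (by decide)] using hf
    · simpa only [hy, harr 3 (by decide)] using hg
    · simp only [Expr.eval, hx, hy, harr 0 (by decide), harr 1 (by decide)] at h
      simp only [h3 s, Cell, h, ne_eq, not_true_eq_false, false_imp_iff, forall_const, true_and]
  · simp only [Expr.cost]; omega

/-- The new table is written from the free address a upwards, above both old tables, which therefore
stay readable. Register 15 accumulates k * q by repeated addition. -/
theorem runs_mergeTwins {m : Memory} {n q x y a : ℕ} (hn : m.reg 0 = n) (hq : m.reg 2 = q)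
    (ha : m.reg 4 = a) (hx : m.reg 10 = x) (hy : m.reg 11 = y) (hxa : m.arr 3 x + n < a)
    (hya : m.arr 3 y + n < a) :
    Runs mergeTwins m ((n + 1) * (n * 70 + 170) + 60) (fun m' =>
      (∀ i, i < 4 ∨ i = 5 → m'.reg i = m.reg i) ∧ m'.reg 4 = a + (n + 1) ∧
      m'.arr 0 = m.arr 0 ∧ m'.arr 1 = m.arr 1 ∧ m'.arr 3 = Function.update (m.arr 3) x a ∧
      m'.arr 4 = Function.update (m.arr 4) y 1 ∧
      m'.arr 5 = Function.update (m.arr 5) x (m.arr 5 x + m.arr 5 y) ∧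
      (∀ i < a, m'.arr 2 i = m.arr 2 i) ∧
      ∀ k ≤ n, ∀ s, s < m'.arr 2 (a + k) ↔ Cell m.arr q x y k s) := by
  refine Runs.seq (T₁ := 2) (Q' := fun m' => m'.arr = m.arr ∧
    (∀ i, i ≠ 15 → m'.reg i = m.reg i) ∧ m'.reg 15 = 0) (T₂ := (n + 1) * (n * 70 + 170) + 58)
    ?_ ?_ (by omega)
  · refine .straight rfl (by decide) ⟨rfl, fun i hi => ?_, ?_⟩ <;>
      simp_all [Program.run, Expr.eval]
  rintro m₁ ⟨ha₁, hr₁, h15₁⟩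
  refine Runs.seq (T₁ := (n + 1) * (n * 70 + 170) + 8) (Q' := fun m' =>
    (∀ i < 12, m'.reg i = m.reg i) ∧ (∀ i, i ≠ 2 → m'.arr i = m.arr i) ∧
    (∀ i < a, m'.arr 2 i = m.arr 2 i) ∧
    ∀ k < n + 1, ∀ s, s < m'.arr 2 (a + k) ↔ Cell m.arr q x y k s) (T₂ := 50) ?_ ?_ (by omega)
  · refine Runs.forLoop (N := n + 1) (T := n * 70 + 160) (Inv := fun j m' => m'.reg 12 = j ∧
      m'.reg 15 = j * q ∧ (∀ i < 12, m'.reg i = m.reg i) ∧ (∀ i, i ≠ 2 → m'.arr i = m.arr i) ∧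
      (∀ i < a, m'.arr 2 i = m.arr 2 i) ∧
      ∀ k < j, ∀ s, s < m'.arr 2 (a + k) ↔ Cell m.arr q x y k s) ?_ ?_ ?_ ?_ ?_
    · refine ⟨by simp, by simp [h15₁], fun i hi => ?_, by simp [ha₁], by simp [ha₁], by simp⟩
      have : i ≠ 12 := by omega
      simp [this, hr₁ i (by omega)]
    · rintro j m' ⟨h12, -, h, -⟩
      exact ⟨h12, by simp only [Expr.eval]; rw [h 0 (by decide), hn]⟩
    · rintro j hj m₂ ⟨h12, h15, hr, harr, hlow, hcell⟩
      refine Runs.seq (T₁ := j * 70 + 130) (T₂ := 20) (runs_entry h12 h15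
        ((hr 10 (by decide)).trans hx) ((hr 11 (by decide)).trans hy) harr
        (fun i hi => hlow _ (by omega)) (fun i hi => hlow _ (by omega))) ?_ (by omega)
      rintro m₃ ⟨ha₃, hr₃, hs⟩
      refine .straight rfl (by decide) ?_
      have e4 : m₃.reg 4 = a := by rw [hr₃ 4 (by decide) (by decide), hr 4 (by decide), ha]
      have e2 : m₃.reg 2 = q := by rw [hr₃ 2 (by decide) (by decide), hr 2 (by decide), hq]
      have e12 : m₃.reg 12 = j := by rw [hr₃ 12 (by decide) (by decide), h12]
      have e15 : m₃.reg 15 = j * q := by rw [hr₃ 15 (by decide) (by decide), h15]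
      simp only [Program.run, Expr.eval, e4, e2, e12, e15, Function.update_apply, Nat.reduceEqDiff,
        if_false, if_true]
      refine ⟨trivial, by ring, fun i hi => ?_, fun i hi => ?_, fun i hi => ?_, fun k hk s => ?_⟩
      · have h1 : i ≠ 12 := by omega
        have h2 : i ≠ 15 := by omega
        simp only [h1, h2, if_false]
        rw [hr₃ i (by omega) (by omega), hr i hi]
      · simp only [hi, if_false, ha₃, harr i hi]
      · have h1 : i ≠ a + j := by omega
        simp only [h1, if_false, ha₃, hlow i hi]
      · rcases Nat.lt_succ_iff_lt_or_eq.1 hk with hk | rfl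
        · have h1 : a + k ≠ a + j := by omega
          simp only [h1, if_false, ha₃]
          exact hcell k hk s
        · simp only [if_true]
          exact hs s
    · simp only [Expr.cost]
      rw [show n * 70 + 160 + (1 + 1 + 1) + 7 = n * 70 + 170 by ring]
    · rintro m' ⟨-, -, h1, h2, h3, h4⟩
      exact ⟨h1, h2, h3, h4⟩
  · rintro m₂ ⟨hr, harr, hlow, hcell⟩
    refine .straight rfl (by decide) ?_
    have e4 : m₂.reg 4 = a := by rw [hr 4 (by decide), ha]
    have e0 : m₂.reg 0 = n := by rw [hr 0 (by decide), hn]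
    have e10 : m₂.reg 10 = x := by rw [hr 10 (by decide), hx]
    have e11 : m₂.reg 11 = y := by rw [hr 11 (by decide), hy]
    simp only [relabel, Program.run, Expr.eval, e4, e0, e10, e11, ne_eq,
      not_false_eq_true, Function.update_of_ne, Function.update_self, Nat.reduceEqDiff,
      OfNat.zero_ne_ofNat, OfNat.one_ne_ofNat, harr]
    refine ⟨fun i hi => ?_, trivial, trivial, trivial, trivial, trivial, trivial, hlow,
      fun k hk => hcell k (by omega)⟩
    have : i ≠ 4 := by omega
    rw [Function.update_of_ne this, hr i (by omega)]


/-! ### The invariant of the merging rounds -/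

variable {n : ℕ} {G : SimpleGraph (Fin n)} {p q r : ℕ}

open Classical in
/-- The part of the memory that does not change during the rounds. -/
structure Static (G : SimpleGraph (Fin n)) (p q r : ℕ) (m : Memory) : Prop where
  reg_zero : m.reg 0 = n
  reg_one : m.reg 1 = p
  reg_two : m.reg 2 = q
  reg_three : m.reg 3 = r
  adj : ∀ u w : Fin n, m.arr 0 (m.arr 1 u + w) = if G.Adj u w then 1 else 0

/-- The memory describes a partition of the vertices into modules `S u`, for the undeleted
vertices `u`. -/
structure Represents (G : SimpleGraph (Fin n)) (q : ℕ) (m : Memory) (live : Finset (Fin n))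
    (S : Fin n → Finset (Fin n)) : Prop where
  mem_live : ∀ u, u ∈ live ↔ m.arr 4 u = 0
  -- The smaller twin is always the one deleted, so vertex n - 1 survives and the answer has a known
  -- location.
  last_mem : ∀ u : Fin n, (u : ℕ) + 1 = n → u ∈ live
  disjoint : ∀ u ∈ live, ∀ v ∈ live, u ≠ v → Disjoint (S u) (S v)
  cover : ∀ x, ∃ u ∈ live, x ∈ S u
  adj_iff : ∀ u ∈ live, ∀ v ∈ live, u ≠ v → ∀ a ∈ S u, ∀ b ∈ S v, (G.Adj a b ↔ G.Adj u v)
  size : ∀ u ∈ live, m.arr 5 u = (S u).card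
  address : ∀ u ∈ live, m.arr 3 u + n < m.reg 4
  table : ∀ u ∈ live, ∀ k ≤ n, ∀ s, Pack G q (S u) k s ↔ s < m.arr 2 (m.arr 3 u + k)

theorem Static.adj_eq_iff {m : Memory} (h : Static G p q r m) (u v w : Fin n) :
    m.arr 0 (m.arr 1 u + w) = m.arr 0 (m.arr 1 v + w) ↔ (G.Adj u w ↔ G.Adj v w) := by
  rw [h.adj, h.adj]
  split_ifs <;> simp_all

theorem twins_iff {m : Memory} {live : Finset (Fin n)} {S : Fin n → Finset (Fin n)}
    (hs : Static G p q r m) (hm : Represents G q m live S) (u v : Fin n) :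
    Twins m.arr n u v ↔ u ∈ live ∧ v ∈ live ∧
      ∀ w ∈ live, w ≠ u → w ≠ v → (G.Adj u w ↔ G.Adj v w) := by
  simp only [Twins, hm.mem_live, Agree]
  refine and_congr_right fun _ => and_congr_right fun _ => ?_
  constructor
  · intro h w h0 h1 h2
    rw [← hs.adj_eq_iff]
    exact h w w.2 h0 (fun e => h1 (Fin.ext e)) (fun e => h2 (Fin.ext e))
  · intro h w hw h0 h1 h2
    have := h ⟨w, hw⟩ h0 (fun e => h1 (congrArg Fin.val e)) (fun e => h2 (congrArg Fin.val e))
    rwa [← hs.adj_eq_iff] at this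

/-- The twin property of cographs holds for every vertex subset, in particular for the live
vertices. -/
theorem exists_twins {m : Memory} {live : Finset (Fin n)} {S : Fin n → Finset (Fin n)}
    (hs : Static G p q r m) (hm : Represents G q m live S) (hG : IsCograph G)
    (hc : 1 < live.card) : ∃ u < n, ∃ v < u, Twins m.arr n u v := by
  obtain ⟨u, hu, v, hv, huv, h⟩ := hG.exists_twins (Finset.subset_univ live) hc
  rcases lt_or_gt_of_ne huv with hlt | hlt
  · exact ⟨v, v.2, u, hlt, (twins_iff hs hm v u).2
      ⟨hv, hu, fun w hw h1 h2 => (h w hw h2 h1).symm⟩⟩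
  · exact ⟨u, u.2, v, hlt, (twins_iff hs hm u v).2 ⟨hu, hv, h⟩⟩

/-- Adjacency between two modules is constant and equals that of their representatives, so their
union is a join or a disjoint union. -/
theorem pack_iff_cell {m : Memory} {live : Finset (Fin n)} {S : Fin n → Finset (Fin n)}
    (hs : Static G p q r m) (hm : Represents G q m live S) (hq : 0 < q) {x y : Fin n}
    (hx : x ∈ live) (hy : y ∈ live) (hxy : x ≠ y) {k : ℕ} (hk : k ≤ n) (s : ℕ) :
    Pack G q (S x ∪ S y) k s ↔ Cell m.arr q x y k s := by
  have hd := hm.disjoint x hx y hy hxy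
  have hadj := hm.adj_iff x hx y hy hxy
  by_cases h : G.Adj x y
  · rw [pack_join_iff hq hd fun a ha b hb => (hadj a ha b hb).2 h,
      hm.table x hx _ (by omega), hm.table y hy _ (by omega)]
    simp only [Cell, hs.adj, h, if_true, JoinCell, hm.size x hx, hm.size y hy]
    simp
  · rw [pack_union_iff hd fun a ha b hb => mt (hadj a ha b hb).1 h]
    simp only [Cell, hs.adj, h, if_false, UnionCell, ne_eq, not_true_eq_false, false_imp_iff,
      true_and, forall_const]
    refine exists_congr fun k₁ => and_congr_right fun hk₁ => exists_congr fun s₁ =>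
      exists_congr fun s₂ => ?_
    rw [hm.table x hx _ (by omega), hm.table y hy _ (by omega)]

theorem Represents.merge {m m' : Memory} {live : Finset (Fin n)} {S : Fin n → Finset (Fin n)}
    (hs : Static G p q r m) (hm : Represents G q m live S) (hq : 0 < q) {x y : Fin n}
    (hyx : y < x) (htw : Twins m.arr n x y)
    (h4 : m'.reg 4 = m.reg 4 + (n + 1))
    (ha3 : m'.arr 3 = Function.update (m.arr 3) x (m.reg 4))
    (ha4 : m'.arr 4 = Function.update (m.arr 4) y 1)
    (ha5 : m'.arr 5 = Function.update (m.arr 5) x (m.arr 5 x + m.arr 5 y))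
    (hlow : ∀ i < m.reg 4, m'.arr 2 i = m.arr 2 i)
    (hcell : ∀ k ≤ n, ∀ s, s < m'.arr 2 (m.reg 4 + k) ↔ Cell m.arr q x y k s) :
    Represents G q m' (live.erase y) (Function.update S x (S x ∪ S y)) := by
  obtain ⟨hx, hy, htw⟩ := (twins_iff hs hm x y).1 htw
  have hxy : x ≠ y := ne_of_gt hyx
  have hval : ∀ {u v : Fin n}, u ≠ v → (u : ℕ) ≠ v := fun h e => h (Fin.ext e)
  have hmem : ∀ {u}, u ∈ live.erase y → u ≠ y ∧ u ∈ live := fun h => Finset.mem_erase.1 h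
  constructor
  · intro u
    rw [Finset.mem_erase, hm.mem_live, ha4]
    by_cases h : u = y
    · simp [h]
    · simp [h, Function.update_of_ne (hval h)]
  · intro u hu
    have : (y : ℕ) < x := hyx
    have := x.2
    exact Finset.mem_erase.2 ⟨fun e => by subst e; omega, hm.last_mem u hu⟩
  · intro u hu v hv huv
    obtain ⟨huy, hu⟩ := hmem hu
    obtain ⟨hvy, hv⟩ := hmem hv
    by_cases h : u = x
    · subst h
      rw [Function.update_self, Function.update_of_ne huv.symm, Finset.disjoint_union_left]
      exact ⟨hm.disjoint _ hu _ hv huv, hm.disjoint _ hy _ hv hvy.symm⟩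
    by_cases h' : v = x
    · subst h'
      rw [Function.update_self, Function.update_of_ne huv, Finset.disjoint_union_right]
      exact ⟨hm.disjoint _ hu _ hv huv, hm.disjoint _ hu _ hy huy⟩
    · rw [Function.update_of_ne h, Function.update_of_ne h']
      exact hm.disjoint _ hu _ hv huv
  · intro z
    obtain ⟨u, hu, hz⟩ := hm.cover z
    by_cases h : u = x ∨ u = y
    · refine ⟨x, Finset.mem_erase.2 ⟨hxy, hx⟩, ?_⟩
      rw [Function.update_self, Finset.mem_union]
      rcases h with rfl | rfl
      · exact Or.inl hz
      · exact Or.inr hz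
    · rw [not_or] at h
      exact ⟨u, Finset.mem_erase.2 ⟨h.2, hu⟩, by rwa [Function.update_of_ne h.1]⟩
  · have key : ∀ w ∈ live, w ≠ x → w ≠ y → ∀ a ∈ S x ∪ S y, ∀ b ∈ S w,
        (G.Adj a b ↔ G.Adj x w) := by
      intro w hw hwx hwy a ha b hb
      rcases Finset.mem_union.1 ha with ha | ha
      · exact hm.adj_iff x hx w hw hwx.symm a ha b hb
      · exact (hm.adj_iff y hy w hw hwy.symm a ha b hb).trans (htw w hw hwx hwy).symm
    intro u hu v hv huv a ha b hb
    obtain ⟨huy, hu⟩ := hmem hu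
    obtain ⟨hvy, hv⟩ := hmem hv
    by_cases h : u = x
    · subst h
      rw [Function.update_self] at ha
      rw [Function.update_of_ne huv.symm] at hb
      exact key v hv huv.symm hvy a ha b hb
    by_cases h' : v = x
    · subst h'
      rw [Function.update_self] at hb
      rw [Function.update_of_ne huv] at ha
      rw [G.adj_comm a, G.adj_comm u]
      exact key u hu huv huy b hb a ha
    · rw [Function.update_of_ne h] at ha
      rw [Function.update_of_ne h'] at hb
      exact hm.adj_iff u hu v hv huv a ha b hb
  · intro u hu
    obtain ⟨huy, hu⟩ := hmem hu
    rw [ha5]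
    by_cases h : u = x
    · subst h
      rw [Function.update_self, Function.update_self,
        Finset.card_union_of_disjoint (hm.disjoint _ hu _ hy huy), hm.size _ hu, hm.size _ hy]
    · rw [Function.update_of_ne h, Function.update_of_ne (hval h), hm.size _ hu]
  · intro u hu
    obtain ⟨huy, hu⟩ := hmem hu
    rw [ha3, h4]
    by_cases h : u = x
    · subst h
      rw [Function.update_self]; omega
    · rw [Function.update_of_ne (hval h)]
      have := hm.address u hu
      omega
  · intro u hu k hk s
    obtain ⟨huy, hu⟩ := hmem hu
    rw [ha3]
    by_cases h : u = x
    · subst h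
      rw [Function.update_self, Function.update_self, hcell k hk,
        pack_iff_cell hs hm hq hu hy huy hk]
    · have := hm.address u hu
      rw [Function.update_of_ne h, Function.update_of_ne (hval h), hlow _ (by omega),
        hm.table u hu k hk]

theorem runs_round {m : Memory} {live : Finset (Fin n)} {S : Fin n → Finset (Fin n)}
    (hs : Static G p q r m) (hm : Represents G q m live S) (hq : 0 < q) (hG : IsCograph G)
    (hc : 1 < live.card) :
    Runs (.seq findTwins mergeTwins) m (700 * n ^ 3) (fun m' => m'.reg 5 = m.reg 5 ∧
      Static G p q r m' ∧
      ∃ live' S', Represents G q m' live' S' ∧ live'.card + 1 = live.card) := by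
  refine Runs.seq (runs_findTwins hs.reg_zero) (T₂ := (n + 1) * (n * 70 + 170) + 60) ?_ ?_
  · rintro m₁ ⟨ha, hr, ht⟩
    obtain ⟨h1, h2, h3⟩ := ht (exists_twins hs hm hG hc)
    obtain ⟨x, hx⟩ : ∃ x : Fin n, (x : ℕ) = m₁.reg 10 := ⟨⟨_, h2⟩, rfl⟩
    obtain ⟨y, hy⟩ : ∃ y : Fin n, (y : ℕ) = m₁.reg 11 := ⟨⟨_, h1.trans h2⟩, rfl⟩
    rw [← hx, ← hy] at h1 h3
    obtain ⟨hxl, hyl, -⟩ := (twins_iff hs hm x y).1 h3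
    refine (runs_mergeTwins (n := n) (q := q) (x := x) (y := y) (a := m.reg 4)
      ((hr 0 (by decide)).trans hs.reg_zero) ((hr 2 (by decide)).trans hs.reg_two)
      (hr 4 (by decide)) hx.symm hy.symm ?_ ?_).mono le_rfl ?_
    · rw [ha]; exact hm.address x hxl
    · rw [ha]; exact hm.address y hyl
    · rintro m₂ ⟨hr₂, h4, ha0, ha1, ha3, ha4, ha5, hlow, hcell⟩
      rw [ha] at ha0 ha1 ha3 ha4 ha5 hlow hcell
      refine ⟨(hr₂ 5 (by decide)).trans (hr 5 (by decide)), ⟨?_, ?_, ?_, ?_, ?_⟩, _, _,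
        hm.merge hs hq h1 h3 h4 ha3 ha4 ha5 hlow hcell, Finset.card_erase_add_one hyl⟩
      · rw [hr₂ 0 (by decide), hr 0 (by decide), hs.reg_zero]
      · rw [hr₂ 1 (by decide), hr 1 (by decide), hs.reg_one]
      · rw [hr₂ 2 (by decide), hr 2 (by decide), hs.reg_two]
      · rw [hr₂ 3 (by decide), hr 3 (by decide), hs.reg_three]
      · intro u w
        rw [ha0, ha1, hs.adj]
  · have hn : 1 ≤ n := by
      have := hc.trans_le (Finset.card_le_univ live)
      rw [Fintype.card_fin] at this
      omega
    have e1 : n * 1 ≤ n * n := Nat.mul_le_mul_left _ hn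
    have e2 : n * n * 1 ≤ n * n * n := Nat.mul_le_mul_left _ hn
    -- The coefficients add up to 678; for n ≥ 1 all lower powers are absorbed into 700 * n ^ 3.
    have e3 : n * (n * (n * 70 + 48) + 14) + 6 + ((n + 1) * (n * 70 + 170) + 60) =
      70 * (n * n * n) + 118 * (n * n) + 254 * n + 236 := by ring
    rw [e3, show n ^ 3 = n * n * n by ring]
    omega

/-- Each round deletes exactly one live vertex, so n - 1 rounds leave one. -/
theorem runs_rounds {m : Memory} (hn : 1 ≤ n) {S : Fin n → Finset (Fin n)}
    (hs : Static G p q r m) (hm : Represents G q m Finset.univ S) (hq : 0 < q)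
    (hG : IsCograph G) :
    Runs (forLoop 5 (.sub (.reg 0) (.const 1)) (.seq findTwins mergeTwins)) m (720 * n ^ 4)
      (fun m' => Static G p q r m' ∧
        ∃ live S', Represents G q m' live S' ∧ live.card = 1) := by
  have hreg : ∀ m x, Static G p q r m →
      Static G p q r { m with reg := Function.update m.reg 5 x } := fun m x h =>
    ⟨by simpa using h.reg_zero, by simpa using h.reg_one, by simpa using h.reg_two,
      by simpa using h.reg_three, h.adj⟩
  have hrep : ∀ m x live S, Represents G q m live S →
      Represents G q { m with reg := Function.update m.reg 5 x } live S := fun m x live S h =>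
    { h with address := by simpa using h.address }
  refine Runs.forLoop (N := n - 1) (T := 700 * n ^ 3) (Inv := fun j m' => m'.reg 5 = j ∧
    Static G p q r m' ∧ ∃ live S', Represents G q m' live S' ∧ live.card + j = n) ?_ ?_ ?_ ?_ ?_
  · exact ⟨by simp, hreg _ _ hs, _, _, hrep _ _ _ _ hm, by simp⟩
  · rintro j m' ⟨h5, hs, -⟩
    exact ⟨h5, by simp only [Expr.eval, hs.reg_zero]⟩
  · rintro j hj m' ⟨h5, hs, live, S', hm, hc⟩
    refine (runs_round hs hm hq hG (by omega)).mono le_rfl ?_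
    rintro m'' ⟨h5', hs', live', S'', hm', hc'⟩
    exact ⟨by simp [h5', h5], hreg _ _ hs', _, _, hrep _ _ _ _ hm', by omega⟩
  · simp only [Expr.cost]
    have h3 : 1 ≤ n ^ 3 := Nat.one_le_pow _ _ hn
    have e1 : n ^ 4 = n * n ^ 3 := by ring
    have e2 : (n - 1) * (700 * n ^ 3 + (1 + 1 + 1) + 7) ≤ n * (710 * n ^ 3) :=
      Nat.mul_le_mul (by omega) (by omega)
    have e3 : n * 1 ≤ n * n ^ 3 := Nat.mul_le_mul_left _ h3
    have e4 : n * (710 * n ^ 3) = 710 * (n * n ^ 3) := by ring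
    omega
  · rintro m' ⟨-, h1, live, S', h2, h3⟩
    exact ⟨h1, live, S', h2, by omega⟩

/-! ### Division, initial tables, answer and total running time -/

/-- Repeated subtraction: the loop test x + 1 - p is nonzero exactly when p ≤ x, and the remainder
decreases because p > 0. -/
theorem runs_divide {m : Memory} (h0 : m.reg 0 = n) (h1 : m.reg 1 = p) (h2 : m.reg 2 = 0)
    (hp : 0 < p) :
    Runs divide m (n * 40 + 20) (fun m' => m'.arr = m.arr ∧
      (∀ i, i ≠ 2 → i ≠ 3 → m'.reg i = m.reg i) ∧ n = p * m'.reg 2 + m'.reg 3 ∧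
      m'.reg 3 < p) := by
  refine Runs.seq (T₁ := 2) (Q' := fun m' => m'.arr = m.arr ∧
    (∀ i, i ≠ 3 → m'.reg i = m.reg i) ∧ m'.reg 3 = n) (T₂ := n * 40 + 18) ?_ ?_ (by omega)
  · exact .straight rfl (by decide) ⟨rfl, fun i hi => by simp [Program.run, hi],
      by simp [Program.run, Expr.eval, h0]⟩
  rintro m₁ ⟨ha, hr, h3⟩
  refine (Runs.loop (Inv := fun m' => m'.arr = m.arr ∧
    (∀ i, i ≠ 2 → i ≠ 3 → m'.reg i = m.reg i) ∧ n = p * m'.reg 2 + m'.reg 3) (T := 20)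
    (fun m => m.reg 3) ⟨ha, fun i _ hi => hr i hi, by rw [hr 2 (by decide), h2, h3]; simp⟩
    ?_).mono ?_ ?_
  · rintro m' ⟨ha', hr', hn⟩ he
    have hp' : m'.reg 1 = p := (hr' 1 (by decide) (by decide)).trans h1
    simp only [Expr.eval, hp'] at he
    refine .straight rfl (by decide) ?_
    simp only [Program.run, Expr.eval, hp', Function.update_apply, Nat.reduceEqDiff, if_false,
      if_true, ha']
    refine ⟨⟨trivial, fun i h2 h3 => by simp [h2, h3, hr' i h2 h3], ?_⟩, by omega⟩
    rw [Nat.mul_add]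
    omega
  · simp only [h3, Expr.cost]; omega
  · rintro m' ⟨⟨h, h', hn⟩, he⟩
    simp only [Expr.eval, (h' 1 (by decide) (by decide)).trans h1] at he
    exact ⟨h, h', hn, by omega⟩

theorem runs_setup {m : Memory} (hq : 0 < q) (h0 : m.reg 0 = n) (h1 : m.reg 1 = p)
    (h2 : m.reg 2 = q) (h3 : m.reg 3 = r) (h12 : m.reg 12 = 0)
    (harr : m.arr = (inputMemory G p).arr) :
    Runs (forLoop 5 (.reg 0) setupVertex) m (n * 80 + 10) (fun m' => Static G p q r m' ∧
      Represents G q m' Finset.univ (fun u => {u})) := by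
  refine Runs.forLoop (N := n) (T := 70) (Inv := fun j m' => m'.reg 5 = j ∧
    (∀ i < 4, m'.reg i = m.reg i) ∧ m'.reg 12 = j * n ∧ m'.arr 0 = m.arr 0 ∧ m'.arr 4 = m.arr 4 ∧
    (∀ i < j, m'.arr 1 i = i * n) ∧ (∀ i < j, m'.arr 3 i + n < m'.reg 4) ∧
    (∀ i < j, m'.arr 5 i = 1) ∧ (∀ a, m'.reg 4 ≤ a → m'.arr 2 a = 0) ∧
    ∀ i < j, ∀ k ≤ n, ∀ s, s < m'.arr 2 (m'.arr 3 i + k) ↔ s = 0 ∧ (k = 0 ∨ k = 1 ∧ q = 1))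
    ?_ ?_ ?_ ?_ ?_
  · refine ⟨by simp, fun i hi => ?_, by simp [h12], rfl, rfl, by simp, by simp, by simp, ?_,
      by simp⟩
    · have : i ≠ 5 := by omega
      simp [this]
    · simp [harr, inputMemory]
  · rintro j m' ⟨h5, hr, -⟩
    exact ⟨h5, by simp only [Expr.eval, hr 0 (by decide), h0]⟩
  · rintro j hj m' ⟨h5, hr, h12, ha0, ha4, ha1, ha3, ha5, ha2, ht⟩
    have e0 : m'.reg 0 = n := by rw [hr 0 (by decide), h0]
    have e2 : m'.reg 2 = q := by rw [hr 2 (by decide), h2]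
    generalize e4 : m'.reg 4 = a at ha3 ha2
    -- Here c is array 2 after the step; its description covers q = 1 and q > 1 together. Cells from
    -- the free address on were 0 before, so only the written entries matter.
    have hrow : ∀ c : ℕ → ℕ, (∀ i < a, c i = m'.arr 2 i) → (∀ i, a ≤ i →
        c i = if i = a ∨ i = a + 1 ∧ q = 1 then 1 else 0) →
        (∀ b, a + (n + 1) ≤ b → c b = 0) ∧ ∀ i < j + 1, ∀ k ≤ n, ∀ s,
          s < c ((if i = j then a else m'.arr 3 i) + k) ↔ s = 0 ∧ (k = 0 ∨ k = 1 ∧ q = 1) := by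
      intro c hc hc'
      refine ⟨fun b hb => ?_, fun i hi k hk s => ?_⟩
      · rw [hc' b (by omega), if_neg (by omega)]
      · split_ifs with h
        · rw [hc' _ (by omega)]
          split_ifs <;> omega
        · have := ha3 i (by omega)
          rw [hc _ (by omega)]
          exact ht i (by omega) k hk s
    have hreg : ∀ i < 4, (if i = 5 then j + 1 else if i = 4 then a + (n + 1) else
        if i = 12 then j * n + n else m'.reg i) = m.reg i := by
      intro i hi
      rw [if_neg (by omega), if_neg (by omega), if_neg (by omega), hr i hi]
    have hoff : ∀ i < j + 1, (if i = j then j * n else m'.arr 1 i) = i * n := by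
      intro i hi
      split_ifs with h
      · rw [h]
      · exact ha1 i (by omega)
    have haddr : ∀ i < j + 1, (if i = j then a else m'.arr 3 i) + n < a + (n + 1) := by
      intro i hi
      split_ifs with h
      · omega
      · have := ha3 i (by omega)
        omega
    have hsize : ∀ i < j + 1, (if i = j then 1 else m'.arr 5 i) = 1 := by
      intro i hi
      split_ifs with h
      · rfl
      · exact ha5 i (by omega)
    refine .straight rfl (by decide) ?_
    by_cases hq1 : q - 1 = 0
    · have hrow := hrow (fun i => if i = a + 1 then 1 else if i = a then 1 else m'.arr 2 i)
        (fun i hi => by split_ifs <;> omega) (fun i hi => by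
          have := ha2 i hi
          split_ifs <;> omega)
      simp only [setupVertex, Program.run, Expr.eval, Function.update_apply, Nat.reduceEqDiff,
        if_false, if_true, e0, e2, e4, h5, h12, hq1, ha0, ha4]
      exact ⟨trivial, hreg, by ring, trivial, trivial, hoff, haddr, hsize, hrow.1, hrow.2⟩
    · have hrow := hrow (fun i => if i = a then 1 else m'.arr 2 i)
        (fun i hi => by split_ifs <;> omega) (fun i hi => by
          have := ha2 i hi
          split_ifs <;> omega)
      simp only [setupVertex, Program.run, Expr.eval, Function.update_apply, Nat.reduceEqDiff,
        if_false, if_true, e0, e2, e4, h5, h12, hq1, ha0, ha4]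
      exact ⟨trivial, hreg, by ring, trivial, trivial, hoff, haddr, hsize, hrow.1, hrow.2⟩
  · simp only [Expr.cost]; omega
  · rintro m' ⟨-, hr, -, ha0, ha4, ha1, ha3, ha5, -, ht⟩
    refine ⟨⟨(hr 0 (by decide)).trans h0, (hr 1 (by decide)).trans h1, (hr 2 (by decide)).trans h2,
      (hr 3 (by decide)).trans h3, fun u w => ?_⟩, ?_⟩
    · rw [ha0, ha1 u u.2, harr]
      -- Quotient and remainder by n recover row and column from a matrix address.
      have key : (0 = 0 ∧ ∃ i j : Fin n, (u : ℕ) * n + w = i * n + j ∧ G.Adj i j) ↔ G.Adj u w := by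
        refine ⟨?_, fun h => ⟨rfl, u, w, rfl, h⟩⟩
        rintro ⟨-, i, j, e, h⟩
        have hn : 0 < n := u.pos
        have e1 := congrArg (· / n) e
        have e2 := congrArg (· % n) e
        simp only [Nat.add_div_of_dvd_right (Dvd.intro_left _ rfl), Nat.mul_div_cancel _ hn,
          Nat.div_eq_of_lt w.2, Nat.div_eq_of_lt j.2, Nat.mul_add_mod_self_right,
          Nat.mod_eq_of_lt w.2, Nat.mod_eq_of_lt j.2, Nat.add_zero] at e1 e2
        rwa [Fin.ext e1, Fin.ext e2]
      classical exact if_congr key rfl rfl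
    · refine ⟨fun u => ?_, fun u _ => Finset.mem_univ _, fun u _ v _ h => by simpa using h,
        fun x => ⟨x, Finset.mem_univ _, by simp⟩, fun u _ v _ h a ha b hb => ?_,
        fun u _ => by simp [ha5 u u.2], fun u _ => ha3 u u.2, fun u _ k hk s => ?_⟩
      · simp [ha4, harr, inputMemory]
      · rw [Finset.mem_singleton.1 ha, Finset.mem_singleton.1 hb]
      · rw [ht u u.2 k hk, pack_singleton_iff hq]

/-- The only live vertex is n - 1 and its module is the whole graph; entry p exceeds r exactly when
r large parts are feasible. -/
theorem runs_answer {m : Memory} {live : Finset (Fin n)} {S : Fin n → Finset (Fin n)}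
    (hn : 1 ≤ n) (hs : Static G p q r m) (hm : Represents G q m live S) (hc : live.card = 1)
    (hp : p ≤ n) : Runs answer m 30 (fun m' => (Pack G q Finset.univ p r → m'.reg 0 = 1) ∧
      (¬ Pack G q Finset.univ p r → m'.reg 0 = 0)) := by
  set z : Fin n := ⟨n - 1, by omega⟩ with hz
  have hzl : z ∈ live := hm.last_mem z (by simp [hz]; omega)
  have hS : S z = Finset.univ := by
    refine Finset.eq_univ_iff_forall.2 fun x => ?_
    obtain ⟨u, hu, hx⟩ := hm.cover x
    rwa [Finset.card_le_one.1 hc.le z hzl u hu]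
  have ht := hm.table z hzl p hp r
  rw [hS] at ht
  have he : (Expr.sub (.get 2 (.add (.get 3 (.sub (.reg 0) (.const 1))) (.reg 1))) (.reg 3)).eval m
      = m.arr 2 (m.arr 3 z + p) - r := by
    simp only [Expr.eval, hs.reg_zero, hs.reg_one, hs.reg_three, hz]
  refine Runs.cond (T₁ := 2) (fun h => ?_) (fun h => ?_) (by simp [Expr.cost])
  · refine .straight rfl (by decide) ⟨fun _ => by simp [Program.run, Expr.eval], fun h' => ?_⟩
    rw [ht] at h'; omega
  · refine .straight rfl (by decide) ⟨fun h' => ?_, fun _ => by simp [Program.run, Expr.eval]⟩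
    rw [ht] at h'; omega

theorem runs_solver (hn : 1 ≤ n) (hG : IsCograph G) (hp : 0 < p) :
    Runs solver (inputMemory G p) (1000 * n ^ 4) (fun m => (IsYesInstance G p → m.reg 0 = 1) ∧
      (¬ IsYesInstance G p → m.reg 0 = 0)) := by
  have hT : n ≤ n ^ 4 := Nat.le_self_pow (by decide) n
  refine Runs.cond (T₁ := 990 * n ^ 4) (fun h => ?_) (fun h => ?_) (by simp only [Expr.cost]; omega)
  · have h' : n < p := by simp only [Expr.eval, inputMemory] at h; simp at h; omega
    refine .straight rfl (by simp [Program.cost, Expr.cost]; omega) ⟨fun hy => ?_, fun _ => ?_⟩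
    · exact absurd hy (not_isYesInstance_of_card_lt (by simpa using h'))
    · simp [Program.run, Expr.eval]
  · have h' : p ≤ n := by simp only [Expr.eval, inputMemory] at h; simp at h; omega
    refine Runs.seq (runs_divide (n := n) (p := p) (by simp [inputMemory]) (by simp [inputMemory])
      (by simp [inputMemory]) hp) (T₂ := 80 * n + 10 + (720 * n ^ 4 + 30)) ?_ (by omega)
    rintro m₁ ⟨ha, hr, hdiv, hlt⟩
    generalize hq : m₁.reg 2 = q at hdiv
    generalize hr' : m₁.reg 3 = r at hdiv hlt
    -- If q were 0, then n = r < p, contrary to p ≤ n.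
    have hq0 : 0 < q := by
      rcases Nat.eq_zero_or_pos q with rfl | h
      · omega
      · exact h
    refine Runs.seq (T₂ := 720 * n ^ 4 + 30)
      (runs_setup (G := G) (p := p) hq0 ?_ ?_ hq hr' ?_ ha) ?_ (by omega)
    · simp [hr, inputMemory]
    · simp [hr, inputMemory]
    · simp [hr, inputMemory]
    rintro m₂ ⟨hs, hm⟩
    refine Runs.seq (runs_rounds hn hs hm hq0 hG) (T₂ := 30) ?_ (by omega)
    rintro m₃ ⟨hs, live, S, hm, hc⟩
    refine (runs_answer hn hs hm hc h').mono le_rfl fun m h => ?_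
    rwa [← isYesInstance_iff_pack (by simpa using hdiv) hlt] at h

end ECP

theorem mainTheorem11 :
    ∃ (prog : ECP.Program) (C : ℕ), ∀ (n p : ℕ) (G : SimpleGraph (Fin n)),
      G.Connected → ECP.IsCograph G → 0 < p → ECP.SolvesWithin prog G p (C * n ^ 4) := by
  refine ⟨ECP.solver, 1000, fun n p G hc hG hp => ?_⟩
  have hn : 1 ≤ n := by
    obtain ⟨v⟩ := hc.nonempty
    exact v.pos
  exact ECP.runs_solver hn hG hp
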